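/- Let $d\ge 1$. For $x_0\in\mathbb{R}^d$ and $l,\sigma>0$ write $S^l_\sigma(x_0):=x_0+(-l,l)\times\left(-\tfrac{\sigma}{2},\tfrac{\sigma}{2}\right)^{d-1}$. For a Lebesgue measurable set $P\subset\mathbb{R}^d$ let $\partial^*P$ be its essential boundary, i.e. the set of points of $\mathbb{R}^d$ at which $P$ has neither $d$-dimensional Lebesgue density $0$ nor density $1$. Let $\mathcal{L}^d$ be Lebesgue measure and $\mathcal{H}^{d-1}$ the $(d-1)$-dimensional Hausdorff measure, normalized to agree with Lebesgue measure on $\mathbb{R}^{d-1}$. A measurable set $P$ has finite perimeter in an open set $U$ if $\sup\left\{\int_P\operatorname{div}\varphi\,dx:\ \varphi\in C^1_c(U;\mathbb{R}^d),\ |\varphi|\le 1\right\}<\infty$. Then there exists a constant $C_{\rm iso}\ge 1$ depending only on $d$ such that for all $l,\sigma>0$ with $l/\sigma\ge 1$, all $x_0\in\mathbb{R}^d$, and every measurable set $P\subset S^l_\sigma(x_0)$ of finite perimeter in $S^l_\sigma(x_0)$ with $$\mathcal{H}^{d-1}\left(\partial^*P\cap S^l_\sigma(x_0)\right)<\sigma^{d-1},$$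 it holds that $$\min\left\{\mathcal{L}^d(P),\ \mathcal{L}^d\left(S^l_\sigma(x_0)\setminus P\right)\right\}\le C_{\rm iso}\,\sigma\,\mathcal{H}^{d-1}\left(\partial^*P\cap S^l_\sigma(x_0)\right).$$ -/

import Mathlib

open MeasureTheory Set Filter
open scoped ENNReal Topology

noncomputable section

namespace LongCuboid

/-- The open cuboid `x₀ + (-l, l) × (-σ/2, σ/2)^(d-1)` in `ℝ^d`; the long direction is the
first coordinate. -/
def cuboid {d : ℕ} (x₀ : EuclideanSpace ℝ (Fin d)) (l σ : ℝ) : Set (EuclideanSpace ℝ (Fin d)) :=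
  {x | ∀ i : Fin d, x i - x₀ i ∈
    if (i : ℕ) = 0 then Ioo (-l) l else Ioo (-(σ / 2)) (σ / 2)}

/-- The divergence of a vector field on `ℝ^d`. -/
def divergence {d : ℕ} (φ : EuclideanSpace ℝ (Fin d) → EuclideanSpace ℝ (Fin d))
    (x : EuclideanSpace ℝ (Fin d)) : ℝ :=
  ∑ i : Fin d, (fderiv ℝ φ x (EuclideanSpace.single i 1)) i

/-- `φ ∈ C_c^1(U; ℝ^d)` with `|φ| ≤ 1` everywhere (Euclidean norm). -/
structure IsTestField {d : ℕ} (U : Set (EuclideanSpace ℝ (Fin d)))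
    (φ : EuclideanSpace ℝ (Fin d) → EuclideanSpace ℝ (Fin d)) : Prop where
  contDiff : ContDiff ℝ 1 φ
  hasCompactSupport : HasCompactSupport φ
  tsupport_subset : tsupport φ ⊆ U
  norm_le_one : ∀ x, ‖φ x‖ ≤ 1

/-- `E` is a (Lebesgue measurable) set of finite perimeter in the open set `U`: the variation
`sup {∫_E div φ : φ ∈ C_c^1(U; ℝ^d), |φ| ≤ 1}` of its indicator function in `U` is finite. -/
structure HasFinitePerimeterIn {d : ℕ} (E U : Set (EuclideanSpace ℝ (Fin d))) : Prop where
  nullMeasurableSet : NullMeasurableSet E volume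
  bddAbove : ∃ M : ℝ, ∀ φ, IsTestField U φ → ∫ x in E, divergence φ x ≤ M

/-- The set `E^s` of points at which `E` has (`d`-dimensional Lebesgue) density `s`. -/
def densityPoints {d : ℕ} (E : Set (EuclideanSpace ℝ (Fin d))) (s : ℝ≥0∞) :
    Set (EuclideanSpace ℝ (Fin d)) :=
  {x | Tendsto (fun r : ℝ => volume (E ∩ Metric.ball x r) / volume (Metric.ball x r))
    (𝓝[>] 0) (𝓝 s)}

/-- The essential boundary `∂*E = ℝ^d \ (E^0 ∪ E^1)`. -/
def essentialBoundary {d : ℕ} (E : Set (EuclideanSpace ℝ (Fin d))) :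
    Set (EuclideanSpace ℝ (Fin d)) :=
  (densityPoints E 0 ∪ densityPoints E 1)ᶜ

/-- `H^{d-1}(∂*E ∩ U)`, with the `(d-1)`-dimensional Hausdorff measure normalized so as to
agree with Lebesgue measure on `(d-1)`-dimensional Euclidean space. -/
def relativePerimeter {d : ℕ} (E U : Set (EuclideanSpace ℝ (Fin d))) : ℝ≥0∞ :=
  Measure.euclideanHausdorffMeasure (d - 1) (essentialBoundary E ∩ U)

end LongCuboid

end

/-!
The perimeter enters through one slicing fact, proved by a Baire category argument in place of `BV`
theory: on almost every line parallel to a coordinate axis, an interval free of points of the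
essential boundary of `P` meets either `P` or its complement in a null set. Hence almost all lines
mixing `P` and its complement lie over the projection of the essential boundary, and projections
do not increase Hausdorff measure.

In units of `σ` the cross section is a unit cube. Let `f t` be the volume fraction of `P` in the
slice at height `t`, let `g = min f (1 - f)`, and let `ν` be the distribution of the boundary along
the long direction. A Poincaré and a Loomis–Whitney inequality, both counting mixed lines, bound
`g ^ α` by `ν` for some `α < 1`, and the mixed lines in the long direction bound the oscillation
of `f` by `ν`. If `f` stays on one side of `1 / 2`, the first bound already gives the theorem.
Otherwise the boundary is bounded below, so it suffices to bound the length of `{f ≤ 1 / 2}` or of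
`{1 / 2 < f}`. When `s < t` lie on different sides, `1 ≤ g s + ν [s, t] + g t`, so that `ν < 1`
forces `ν (-∞, s) < g s` or `ν (t, ∞) < g t`; but `F t = ν (-∞, t) < g t` together with
`g ^ α ≤ K F'` is possible only on a set of bounded length. This makes the constant independent of
the length of the cuboid.
-/

namespace LongCuboid

open Metric
open scoped NNReal

section Density

variable {X : Type*} [PseudoMetricSpace X] [MeasurableSpace X]

/-- The points at which `A` has density zero with respect to `μ`. On `EuclideanSpace ℝ (Fin d)` with
Lebesgue measure this is `densityPoints A 0`; the slicing argument needs it on products, which carry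
the sup distance. -/
def zeroDensityPoints (μ : Measure X) (A : Set X) : Set X :=
  {x | Tendsto (fun r : ℝ => μ (A ∩ ball x r) / μ (ball x r)) (𝓝[>] 0) (𝓝 0)}

/-- The points around which `A` occupies at most the fraction `c` of every ball of radius less than
`ρ`: the closed sets that exhaust `zeroDensityPoints μ A` in the Baire category argument. -/
def thinPoints (μ : Measure X) (c : ℝ≥0∞) (A : Set X) (ρ : ℝ) : Set X :=
  {x | ∀ r ∈ Ioo 0 ρ, μ (A ∩ ball x r) ≤ c * μ (ball x r)}

lemma thinPoints_anti (μ : Measure X) (c : ℝ≥0∞) (A : Set X) : Antitone (thinPoints μ c A) :=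
  fun _ _ h _ hx r hr => hx r (Ioo_subset_Ioo_right h hr)

lemma isOpen_lt_measure_inter_ball (μ : Measure X) (A : Set X) (r : ℝ) (c : ℝ≥0∞) :
    IsOpen {x | c < μ (A ∩ ball x r)} := by
  refine Metric.isOpen_iff.2 fun x hx => ?_
  have hU : A ∩ ball x r = ⋃ k : ℕ, A ∩ ball x (r - 1 / (k + 1)) := by
    rw [← inter_iUnion]
    congr 1
    ext y
    simp only [mem_ball, mem_iUnion]
    constructor
    · intro h
      obtain ⟨k, hk⟩ := exists_nat_one_div_lt (sub_pos.2 h)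
      exact ⟨k, by linarith⟩
    · rintro ⟨k, hk⟩
      exact hk.trans (sub_lt_self r Nat.one_div_pos_of_nat)
  have hmono : Monotone fun k : ℕ => A ∩ ball x (r - 1 / (k + 1)) := fun k k' hk =>
    inter_subset_inter_right _ (ball_subset_ball (sub_le_sub_left (Nat.one_div_le_one_div hk) r))
  rw [mem_ofPred_eq, hU, hmono.measure_iUnion, lt_iSup_iff] at hx
  obtain ⟨k, hk⟩ := hx
  refine ⟨1 / (k + 1), Nat.one_div_pos_of_nat, fun y hy => hk.trans_le (measure_mono ?_)⟩
  refine inter_subset_inter_right _ (ball_subset_ball' ?_)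
  rw [mem_ball, dist_comm] at hy
  linarith

lemma zeroDensityPoints_subset_iUnion_thinPoints (μ : Measure X) {c : ℝ≥0∞} (hc : c ≠ 0)
    (A : Set X) : zeroDensityPoints μ A ⊆ ⋃ k : ℕ, thinPoints μ c A (1 / (k + 1)) := by
  intro x hx
  have hsmall : ∀ᶠ r in 𝓝[>] (0 : ℝ), μ (A ∩ ball x r) / μ (ball x r) < c :=
    Tendsto.eventually_lt_const (pos_iff_ne_zero.2 hc) hx
  obtain ⟨ρ, hρ, hsub⟩ := mem_nhdsGT_iff_exists_Ioo_subset.1 hsmall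
  obtain ⟨k, hk⟩ := exists_nat_one_div_lt (mem_Ioi.1 hρ)
  refine mem_iUnion.2 ⟨k, fun r hr => ?_⟩
  have hdiv := hsub ⟨hr.1, hr.2.trans hk⟩
  rcases eq_or_ne (μ (ball x r)) 0 with h0 | h0
  · rw [measure_mono_null inter_subset_right h0]
    exact zero_le
  · exact (ENNReal.div_le_iff_le_mul (Or.inl h0) (Or.inr hc)).1 hdiv.le

variable [ProperSpace X] (μ : Measure X) [μ.IsOpenPosMeasure] [IsFiniteMeasureOnCompacts μ]

lemma disjoint_thinPoints_zeroDensityPoints_compl {c : ℝ≥0∞} (hc : c < 1) (A : Set X)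
    {ρ : ℝ} (hρ : 0 < ρ) : Disjoint (thinPoints μ c A ρ) (zeroDensityPoints μ Aᶜ) := by
  refine disjoint_left.2 fun x hthin hzero => ?_
  have hsmall : ∀ᶠ r in 𝓝[>] (0 : ℝ), μ (Aᶜ ∩ ball x r) / μ (ball x r) < 1 - c :=
    Tendsto.eventually_lt_const (tsub_pos_of_lt hc) hzero
  obtain ⟨r, hr, hr0, hrρ⟩ := (hsmall.and (Ioo_mem_nhdsGT hρ)).exists
  have hpos : μ (ball x r) ≠ 0 := (measure_ball_pos μ x hr0).ne'
  have hfin : μ (ball x r) ≠ ∞ := measure_ball_lt_top.ne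
  refine lt_irrefl (μ (ball x r)) ?_
  calc μ (ball x r) ≤ μ (A ∩ ball x r) + μ (Aᶜ ∩ ball x r) := by
        rw [inter_comm, inter_comm Aᶜ]
        exact measure_le_inter_add_sdiff μ _ A
    _ < c * μ (ball x r) + (1 - c) * μ (ball x r) :=
        ENNReal.add_lt_add_of_le_of_lt (measure_ne_top_of_subset inter_subset_right hfin)
          (hthin r ⟨hr0, hrρ⟩)
          ((ENNReal.div_lt_iff (Or.inl hpos) (Or.inl hfin)).1 hr)
    _ = μ (ball x r) := by rw [← add_mul, add_tsub_cancel_of_le hc.le, one_mul]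

lemma disjoint_zeroDensityPoints_compl (A : Set X) :
    Disjoint (zeroDensityPoints μ A) (zeroDensityPoints μ Aᶜ) := by
  refine Disjoint.mono_left
    (zeroDensityPoints_subset_iUnion_thinPoints μ (c := 2⁻¹) (by simp) A)
    (disjoint_iUnion_left.2 fun k => ?_)
  exact disjoint_thinPoints_zeroDensityPoints_compl μ ENNReal.one_half_lt_one A
    Nat.one_div_pos_of_nat

end Density

lemma isClosed_thinPoints {X : Type*} [NormedAddCommGroup X] [MeasurableSpace X] [BorelSpace X]
    (μ : Measure X) [μ.IsAddHaarMeasure] (c : ℝ≥0∞) (A : Set X) (ρ : ℝ) :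
    IsClosed (thinPoints μ c A ρ) := by
  have h : thinPoints μ c A ρ =
      ⋂ r ∈ Ioo 0 ρ, {x | c * μ (ball 0 r) < μ (A ∩ ball x r)}ᶜ := by
    ext x
    simp [thinPoints, Measure.addHaar_ball_center μ x]
  rw [h]
  exact isClosed_biInter fun r _ => (isOpen_lt_measure_inter_ball μ A r _).isClosed_compl

section NormedSpace

variable {X : Type*} [NormedAddCommGroup X] [NormedSpace ℝ X] [FiniteDimensional ℝ X]
  [MeasurableSpace X] [BorelSpace X] (μ : Measure X) [μ.IsAddHaarMeasure]

lemma ae_mem_zeroDensityPoints_of_notMem {A : Set X} (hA : MeasurableSet A) :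
    ∀ᵐ x ∂μ, x ∉ A → x ∈ zeroDensityPoints μ A := by
  filter_upwards [Besicovitch.ae_tendsto_measure_inter_div_of_measurableSet μ hA] with x hx hxA
  rw [indicator_of_notMem hxA] at hx
  refine tendsto_of_tendsto_of_tendsto_of_le_of_le' tendsto_const_nhds hx
    (Eventually.of_forall fun _ => zero_le) ?_
  filter_upwards [self_mem_nhdsWithin] with r hr
  rw [Measure.addHaar_closedBall μ x (le_of_lt hr), Measure.addHaar_ball_of_pos μ x hr]
  gcongr
  exact ball_subset_closedBall

lemma ae_mem_zeroDensityPoints_iff {A : Set X} (hA : MeasurableSet A) :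
    ∀ᵐ x ∂μ, (x ∈ zeroDensityPoints μ A ↔ x ∉ A) ∧ (x ∈ zeroDensityPoints μ Aᶜ ↔ x ∈ A) := by
  filter_upwards [ae_mem_zeroDensityPoints_of_notMem μ hA,
    ae_mem_zeroDensityPoints_of_notMem μ hA.compl] with x h0 h1
  have hdisj : x ∈ zeroDensityPoints μ A → x ∉ zeroDensityPoints μ Aᶜ := fun h =>
    disjoint_left.1 (disjoint_zeroDensityPoints_compl μ A) h
  rw [notMem_compl_iff] at h1
  exact ⟨⟨fun h hxA => hdisj h (h1 hxA), h0⟩,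
    ⟨fun h => by_contra fun hxA => hdisj (h0 hxA) h, h1⟩⟩

end NormedSpace

lemma exists_measure_closedBall_div_two_le {X : Type*} [MetricSpace X] [MeasurableSpace X]
    [BorelSpace X] [SecondCountableTopology X] [HasBesicovitchCovering X] (μ : Measure X)
    [IsLocallyFiniteMeasure μ] {s : Set X} (hs : μ s ≠ 0) {ε : ℝ} (hε : 0 < ε) :
    ∃ z ∈ s, ∃ r ∈ Ioo 0 ε, μ (closedBall z r) / 2 ≤ μ (s ∩ closedBall z r) := by
  obtain ⟨z, hz, ht⟩ : ∃ z ∈ s,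
      Tendsto (fun r => μ (s ∩ closedBall z r) / μ (closedBall z r)) (𝓝[>] 0) (𝓝 1) := by
    by_contra! hcon
    have hnull := (Measure.le_restrict_apply s _).trans_eq
      (mem_ae_iff.1 (Besicovitch.ae_tendsto_measure_inter_div μ s))
    refine hs (measure_mono_null ?_ (nonpos_iff_eq_zero.1 hnull))
    exact fun z hz => ⟨hcon z hz, hz⟩
  obtain ⟨r, hr, hrε⟩ := ((ht.eventually_const_lt ENNReal.one_half_lt_one).and
    (Ioo_mem_nhdsGT hε)).exists
  refine ⟨z, hz, r, hrε, ?_⟩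
  rw [div_eq_mul_inv, mul_comm]
  exact ENNReal.mul_le_of_le_div hr.le

section Lines

variable {F : Type*} [NormedAddCommGroup F]

/-- Take a point `x` of `N` with `ε * x.1` within `r` of its supremum. -/
lemma exists_box_subset_inter_ball {N J : Set (ℝ × F)} {ε ρ r : ℝ} (hε : |ε| = 1)
    (hr : r ∈ Ioo 0 (ρ / 8)) (hN : N.Nonempty)
    (hclose : ∀ x ∈ N, ∀ y ∈ N, ε * x.1 - ε * y.1 < ρ / 4)
    (hdist : ∀ x ∈ N, ∀ y ∈ N, dist x.2 y.2 ≤ 2 * r)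
    (hmove : ∀ x ∈ N, ∀ s ∈ Ioo 0 ρ, (x.1 + ε * s, x.2) ∈ J) :
    ∃ x ∈ N, ∃ τ, ((ε * ·) ⁻¹' Ioo τ (τ + r)) ×ˢ (Prod.snd '' N) ⊆ J ∩ ball x (4 * r) := by
  obtain ⟨hr0, hrρ⟩ := hr
  set T := (fun x : ℝ × F => ε * x.1) '' N
  obtain ⟨x₁, hx₁⟩ := hN
  have hbdd : BddAbove T := by
    refine ⟨ε * x₁.1 + ρ / 4, ?_⟩
    rintro _ ⟨y, hy, rfl⟩
    linarith [hclose y hy x₁ hx₁]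
  have hle : ∀ y ∈ N, ε * y.1 ≤ sSup T := fun y hy => le_csSup hbdd ⟨y, hy, rfl⟩
  obtain ⟨_, ⟨x, hx, rfl⟩, hxsup⟩ := exists_lt_of_lt_csSup (⟨_, x₁, hx₁, rfl⟩ : T.Nonempty)
    (sub_lt_self (sSup T) hr0)
  refine ⟨x, hx, sSup T, ?_⟩
  rintro ⟨t, _⟩ ⟨⟨ht, ht'⟩, y, hy, rfl⟩
  have hyx := hclose x hx y hy
  have hyle := hle y hy
  have hxle := hle x hx
  constructor
  · have hmem := hmove y hy (ε * t - ε * y.1) ⟨by linarith, by linarith⟩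
    rwa [← mul_sub, ← mul_assoc, ← abs_mul_abs_self ε, hε, one_mul, one_mul,
      add_sub_cancel] at hmem
  · rw [mem_ball, Prod.dist_eq, max_lt_iff]
    refine ⟨?_, (hdist y hy x hx).trans_lt (by linarith)⟩
    have : |t - x.1| = |ε * t - ε * x.1| := by rw [← mul_sub, abs_mul, hε, one_mul]
    rw [Real.dist_eq, this, abs_lt]
    constructor <;> linarith

variable [NormedSpace ℝ F] [FiniteDimensional ℝ F] [MeasurableSpace F] [BorelSpace F]
  (ν : Measure F) [ν.IsAddHaarMeasure]

lemma mul_prod_ball_lt_mul_closedBall {c : ℝ≥0∞}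
    (hc : c * (16 * 4 ^ Module.finrank ℝ F) < 1) (x : ℝ × F) (z : F) {r : ℝ} (hr : 0 < r) :
    c * ((volume : Measure ℝ).prod ν) (ball x (4 * r)) <
      ENNReal.ofReal r * (ν (closedBall z r) / 2) := by
  set b := ENNReal.ofReal r * ν (closedBall z r) with hb
  have hb0 : b ≠ 0 := mul_ne_zero (by simpa using hr) (measure_closedBall_pos ν z hr).ne'
  have hbtop : b ≠ ∞ := ENNReal.mul_ne_top ENNReal.ofReal_ne_top measure_closedBall_lt_top.ne
  have hball : ((volume : Measure ℝ).prod ν) (ball x (4 * r)) =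
      8 * 4 ^ Module.finrank ℝ F * b := by
    rw [← ball_prod_same, Measure.prod_prod, Real.volume_ball,
      Measure.addHaar_ball_of_pos ν x.2 (by positivity), hb, Measure.addHaar_closedBall ν z hr.le,
      mul_pow, ← mul_assoc, ← ENNReal.ofReal_mul (by positivity), ← mul_assoc 2 4 r]
    rw [show 2 * 4 * r * (4 ^ Module.finrank ℝ F * r ^ Module.finrank ℝ F) =
      8 * 4 ^ Module.finrank ℝ F * (r * r ^ Module.finrank ℝ F) by ring,
      ENNReal.ofReal_mul (by positivity), ENNReal.ofReal_mul (by positivity),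
      ENNReal.ofReal_mul hr.le, ENNReal.ofReal_pow (by norm_num)]
    norm_num
    ring
  have hhalf : ENNReal.ofReal r * (ν (closedBall z r) / 2) = b * 2⁻¹ := by
    rw [hb, mul_assoc, div_eq_mul_inv]
  have htwo : (16 : ℝ≥0∞) * 2⁻¹ = 8 := by
    rw [show (16 : ℝ≥0∞) = 8 * 2 by norm_num, mul_assoc, ENNReal.mul_inv_cancel (by simp) (by simp),
      mul_one]
  calc c * ((volume : Measure ℝ).prod ν) (ball x (4 * r))
      = c * (16 * 4 ^ Module.finrank ℝ F) * (b * 2⁻¹) := by rw [hball, ← htwo]; ring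
    _ < 1 * (b * 2⁻¹) := ENNReal.mul_lt_mul_left (by simpa using hb0)
        (ENNReal.mul_ne_top hbtop (by simp)) hc
    _ = ENNReal.ofReal r * (ν (closedBall z r) / 2) := by rw [hhalf, one_mul]

lemma measure_snd_image_thinPoints_eq_zero {A J : Set (ℝ × F)}
    (hJ : ((volume : Measure ℝ).prod ν) (J \ A) = 0) {c : ℝ≥0∞}
    (hc : c * (16 * 4 ^ Module.finrank ℝ F) < 1) {ρ ε : ℝ} (hρ : 0 < ρ) (hε : |ε| = 1) :
    ν (Prod.snd '' {x ∈ thinPoints ((volume : Measure ℝ).prod ν) c A ρ |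
      ∀ s ∈ Ioo 0 ρ, (x.1 + ε * s, x.2) ∈ J}) = 0 := by
  set μ := (volume : Measure ℝ).prod ν
  set M := {x ∈ thinPoints μ c A ρ | ∀ s ∈ Ioo 0 ρ, (x.1 + ε * s, x.2) ∈ J}
  -- Cut `M` into slabs of width `ρ / 4`.
  have hcover : Prod.snd '' M ⊆ ⋃ j : ℤ, Prod.snd '' (M ∩ {x | ⌊ε * x.1 / (ρ / 4)⌋ = j}) := by
    rintro _ ⟨x, hx, rfl⟩
    exact mem_iUnion.2 ⟨_, x, ⟨hx, rfl⟩, rfl⟩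
  refine measure_mono_null hcover (measure_iUnion_null fun j => ?_)
  set S := M ∩ {x | ⌊ε * x.1 / (ρ / 4)⌋ = j}
  have hclose : ∀ x ∈ S, ∀ y ∈ S, ε * x.1 - ε * y.1 < ρ / 4 := fun x hx y hy => by
    have h := (abs_lt.1 (Int.abs_sub_lt_one_of_floor_eq_floor (hx.2.trans hy.2.symm))).2
    rwa [← sub_div, div_lt_one (by positivity)] at h
  by_contra hpos
  obtain ⟨_, ⟨x₁, hx₁, rfl⟩, r, hr, hhalf⟩ := exists_measure_closedBall_div_two_le ν hpos
    (show 0 < ρ / 8 by positivity)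
  set N := S ∩ Prod.snd ⁻¹' closedBall x₁.2 r
  obtain ⟨x, hx, τ, hbox⟩ := exists_box_subset_inter_ball (N := N) (J := J) hε hr
    ⟨x₁, hx₁, mem_closedBall_self hr.1.le⟩ (fun x hx y hy => hclose x hx.1 y hy.1)
    (fun x hx y hy => (dist_triangle_right x.2 y.2 x₁.2).trans
      ((add_le_add hx.2 hy.2).trans_eq (two_mul r).symm)) (fun x hx => hx.1.1.2)
  have hwidth : volume ((ε * ·) ⁻¹' Ioo τ (τ + r)) = ENNReal.ofReal r := by
    rw [Real.volume_preimage_mul_left (by rintro rfl; norm_num at hε), abs_inv, hε]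
    simp
  refine lt_irrefl _ ((mul_prod_ball_lt_mul_closedBall ν hc x x₁.2 hr.1).trans_le ?_)
  calc ENNReal.ofReal r * (ν (closedBall x₁.2 r) / 2)
      ≤ ENNReal.ofReal r * ν (Prod.snd '' N) := by
        rw [image_inter_preimage]
        gcongr
    _ = μ (((ε * ·) ⁻¹' Ioo τ (τ + r)) ×ˢ (Prod.snd '' N)) := by
        rw [Measure.prod_prod, hwidth]
    _ ≤ μ (J ∩ ball x (4 * r)) := measure_mono hbox
    _ ≤ μ (A ∩ ball x (4 * r)) := measure_mono_ae (by
        filter_upwards [measure_eq_zero_iff_ae_notMem.1 hJ] with y hy hyJ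
        exact ⟨by_contra fun hyA => hy ⟨hyJ.1, hyA⟩, hyJ.2⟩)
    _ ≤ c * μ (ball x (4 * r)) :=
        hx.1.1.1 _ ⟨by linarith [hr.1], by linarith [hr.2]⟩

lemma ae_forall_mem_thinPoints_exists_notMem {A : Set (ℝ × F)} (hA : MeasurableSet A) {c : ℝ≥0∞}
    (hc : c * (16 * 4 ^ Module.finrank ℝ F) < 1) :
    ∀ᵐ z ∂ν, ∀ ρ > 0, ∀ ε : ℝ, |ε| = 1 → ∀ t,
      (t, z) ∈ thinPoints ((volume : Measure ℝ).prod ν) c A ρ →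
      ∃ s ∈ Ioo 0 ρ, (t + ε * s, z) ∉ zeroDensityPoints ((volume : Measure ℝ).prod ν) Aᶜ := by
  set μ := (volume : Measure ℝ).prod ν
  have hnull : μ (zeroDensityPoints μ Aᶜ \ A) = 0 := by
    refine measure_eq_zero_iff_ae_notMem.2 ?_
    filter_upwards [ae_mem_zeroDensityPoints_iff μ hA] with x hx hxA
    exact hxA.2 (hx.2.1 hxA.1)
  have hfixed : ∀ m : ℕ, ∀ᵐ z ∂ν, ∀ ε : ℝ, |ε| = 1 → ∀ t,
      (t, z) ∈ thinPoints μ c A (1 / (m + 1)) →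
      ∃ s ∈ Ioo (0 : ℝ) (1 / (m + 1)), (t + ε * s, z) ∉ zeroDensityPoints μ Aᶜ := fun m => by
    have himage := fun ε hε => measure_eq_zero_iff_ae_notMem.1
      (measure_snd_image_thinPoints_eq_zero ν hnull hc (ρ := 1 / (m + 1)) (ε := ε)
        Nat.one_div_pos_of_nat hε)
    filter_upwards [himage 1 (by simp), himage (-1) (by simp)] with z hright hleft ε hε t ht
    by_contra! hcon
    rcases eq_or_eq_neg_of_abs_eq hε with rfl | rfl
    · exact hright ⟨(t, z), ⟨ht, hcon⟩, rfl⟩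
    · exact hleft ⟨(t, z), ⟨ht, hcon⟩, rfl⟩
  filter_upwards [ae_all_iff.2 hfixed] with z hz ρ hρ ε hε t ht
  obtain ⟨m, hm⟩ := exists_nat_one_div_lt hρ
  obtain ⟨s, hs, hst⟩ := hz m ε hε t (thinPoints_anti μ c A hm.le ht)
  exact ⟨s, Ioo_subset_Ioo_right hm.le hs, hst⟩

end Lines

section Baire

lemma exists_one_sided_gap {C : Set ℝ} (hC : IsClosed C) {x₀ q : ℝ} (hx₀ : x₀ ∈ C) (hq : q ∉ C) :
    ∃ ε : ℝ, |ε| = 1 ∧ ∃ ρ > 0, ∃ x ∈ C ∩ uIcc x₀ q,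
      ∀ s ∈ Ioo 0 ρ, x + ε * s ∈ uIcc x₀ q \ C := by
  have hcompact : IsCompact (C ∩ uIcc x₀ q) := isCompact_uIcc.inter_left hC
  have hne : (C ∩ uIcc x₀ q).Nonempty := ⟨x₀, hx₀, left_mem_uIcc⟩
  have hqx : q ≠ x₀ := fun h => hq (h ▸ hx₀)
  rcases lt_or_gt_of_ne hqx with h | h
  · rw [uIcc_of_ge h.le] at hcompact hne ⊢
    obtain ⟨x, hx, hleast⟩ := hcompact.exists_isLeast hne
    have hqx : q < x := lt_of_le_of_ne hx.2.1 fun e => hq (e ▸ hx.1)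
    refine ⟨-1, by simp, x - q, sub_pos.2 hqx, x, hx, fun s hs => ?_⟩
    have hmem : x + -1 * s ∈ Icc q x₀ := ⟨by linarith [hs.2], by linarith [hs.1, hx.2.2]⟩
    exact ⟨hmem, fun hxC => by linarith [hleast ⟨hxC, hmem⟩, hs.1]⟩
  · rw [uIcc_of_le h.le] at hcompact hne ⊢
    obtain ⟨x, hx, hgreatest⟩ := hcompact.exists_isGreatest hne
    have hxq : x < q := lt_of_le_of_ne hx.2.2 fun e => hq (e ▸ hx.1)
    refine ⟨1, by simp, q - x, sub_pos.2 hxq, x, hx, fun s hs => ?_⟩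
    have hmem : x + 1 * s ∈ Icc x₀ q := ⟨by linarith [hs.1, hx.2.1], by linarith [hs.2]⟩
    exact ⟨hmem, fun hxC => by linarith [hgreatest ⟨hxC, hmem⟩, hs.1]⟩

lemma exists_one_sided_of_boundary_subset {P Q F : Set ℝ} {u v x₀ δ : ℝ} (hPQ : P ∪ Q = Icc u v)
    (hFQ : Disjoint F Q) (hδ : 0 < δ) (hx₀ : x₀ ∈ closure P ∩ closure Q)
    (hF : closure P ∩ closure Q ∩ ball x₀ δ ⊆ F) :
    ∃ ε : ℝ, |ε| = 1 ∧ ∃ ρ > 0, ∃ x ∈ F, ∀ s ∈ Ioo 0 ρ, x + ε * s ∈ Q := by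
  obtain ⟨q, hq, hqδ⟩ := Metric.mem_closure_iff.1 hx₀.2 δ hδ
  rw [dist_comm] at hqδ
  have hqP : q ∉ closure P := fun h =>
    disjoint_left.1 hFQ (hF ⟨⟨h, subset_closure hq⟩, hqδ⟩) hq
  obtain ⟨ε, hε, ρ, hρ, x, ⟨hxP, hx⟩, hgap⟩ := exists_one_sided_gap isClosed_closure hx₀.1 hqP
  have hsub : uIcc x₀ q ⊆ P ∪ Q := by
    rw [hPQ]
    refine ordConnected_Icc.uIcc_subset ?_ (hPQ ▸ Or.inr hq)
    exact closure_minimal (hPQ ▸ subset_union_left) isClosed_Icc hx₀.1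
  have hQ : ∀ s ∈ Ioo 0 ρ, x + ε * s ∈ Q := fun s hs =>
    (hsub (hgap s hs).1).resolve_left fun h => (hgap s hs).2 (subset_closure h)
  have hxQ : x ∈ closure Q := by
    have hlim : Tendsto (fun s => x + ε * s) (𝓝[>] 0) (𝓝 x) :=
      ((by fun_prop : Continuous fun s => x + ε * s).tendsto' 0 x (by simp)).mono_left
        nhdsWithin_le_nhds
    exact mem_closure_of_tendsto hlim (mem_of_superset (Ioo_mem_nhdsGT hρ) hQ)
  exact ⟨ε, hε, ρ, hρ, x, hF ⟨⟨hxP, hxQ⟩, (abs_sub_left_of_mem_uIcc hx).trans_lt hqδ⟩, hQ⟩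

/-- By Baire, one of the closed sets contains a relatively open piece of the common boundary of `P`
and `Q`. -/
lemma exists_one_sided_of_cover {P Q : Set ℝ} {u v : ℝ} (hPQ : P ∪ Q = Icc u v)
    {F G : ℕ → Set ℝ} (hFc : ∀ k, IsClosed (F k)) (hGc : ∀ k, IsClosed (G k))
    (hPF : P ⊆ ⋃ k, F k) (hQG : Q ⊆ ⋃ k, G k)
    (hFQ : ∀ k, Disjoint (F k) Q) (hGP : ∀ k, Disjoint (G k) P)
    (hP : P.Nonempty) (hQ : Q.Nonempty) :
    ∃ ε : ℝ, |ε| = 1 ∧ ∃ ρ > 0, ∃ k, ∃ x, (x ∈ F k ∧ ∀ s ∈ Ioo 0 ρ, x + ε * s ∈ Q) ∨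
      (x ∈ G k ∧ ∀ s ∈ Ioo 0 ρ, x + ε * s ∈ P) := by
  set D := closure P ∩ closure Q
  have hDI : D ⊆ Icc u v :=
    inter_subset_left.trans (closure_minimal (hPQ ▸ subset_union_left) isClosed_Icc)
  have hDne : D.Nonempty := by
    refine (isPreconnected_closed_iff.1 (isPreconnected_Icc (a := u) (b := v)) (closure P)
      (closure Q) isClosed_closure isClosed_closure ?_ ?_ ?_).mono inter_subset_right
    · exact hPQ ▸ union_subset_union subset_closure subset_closure
    · exact hP.mono fun x hx => ⟨hPQ ▸ Or.inl hx, subset_closure hx⟩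
    · exact hQ.mono fun x hx => ⟨hPQ ▸ Or.inr hx, subset_closure hx⟩
  have : CompactSpace D := isCompact_iff_compactSpace.1
    (isCompact_Icc.of_isClosed_subset (isClosed_closure.inter isClosed_closure) hDI)
  have : Nonempty D := hDne.to_subtype
  let C : ℕ ⊕ ℕ → Set D := Sum.elim (fun k => (↑) ⁻¹' F k) (fun k => (↑) ⁻¹' G k)
  have hC : ∀ i, IsClosed (C i) := by
    rintro (k | k)
    · exact (hFc k).preimage continuous_subtype_val
    · exact (hGc k).preimage continuous_subtype_val
  have hcover : ⋃ i, C i = univ := by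
    refine eq_univ_of_forall fun x => ?_
    rcases hPQ ▸ hDI x.2 with h | h
    · obtain ⟨k, hk⟩ := mem_iUnion.1 (hPF h)
      exact mem_iUnion.2 ⟨Sum.inl k, hk⟩
    · obtain ⟨k, hk⟩ := mem_iUnion.1 (hQG h)
      exact mem_iUnion.2 ⟨Sum.inr k, hk⟩
  obtain ⟨i, x₀, hx₀⟩ := nonempty_interior_of_iUnion_of_closed hC hcover
  obtain ⟨δ, hδ, hball⟩ := Metric.mem_nhds_iff.1 (mem_interior_iff_mem_nhds.1 hx₀)
  rcases i with k | k
  · obtain ⟨ε, hε, ρ, hρ, x, hx, h⟩ := exists_one_sided_of_boundary_subset hPQ (hFQ k) hδ x₀.2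
      fun x hx => hball (show (⟨x, hx.1⟩ : D) ∈ ball x₀ δ from hx.2)
    exact ⟨ε, hε, ρ, hρ, k, x, Or.inl ⟨hx, h⟩⟩
  · obtain ⟨ε, hε, ρ, hρ, x, hx, h⟩ := exists_one_sided_of_boundary_subset
      (union_comm P Q ▸ hPQ) (hGP k) hδ x₀.2.symm
      fun x hx => hball (show (⟨x, hx.1.symm⟩ : D) ∈ ball x₀ δ from hx.2)
    exact ⟨ε, hε, ρ, hρ, k, x, Or.inr ⟨hx, h⟩⟩

end Baire

section Slicing

variable {F : Type*} [NormedAddCommGroup F] [NormedSpace ℝ F] [FiniteDimensional ℝ F]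
  [MeasurableSpace F] [BorelSpace F] (ν : Measure F) [ν.IsAddHaarMeasure]

lemma ae_forall_Ioo_zeroDensityPoints_or {E : Set (ℝ × F)} (hE : MeasurableSet E) :
    ∀ᵐ z ∂ν, ∀ a b : ℝ,
      (∀ t ∈ Ioo a b, (t, z) ∈ zeroDensityPoints ((volume : Measure ℝ).prod ν) E ∪
        zeroDensityPoints ((volume : Measure ℝ).prod ν) Eᶜ) →
      (∀ t ∈ Ioo a b, (t, z) ∈ zeroDensityPoints ((volume : Measure ℝ).prod ν) E) ∨
      (∀ t ∈ Ioo a b, (t, z) ∈ zeroDensityPoints ((volume : Measure ℝ).prod ν) Eᶜ) := by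
  set μ := (volume : Measure ℝ).prod ν
  have hK : (1 : ℝ≥0∞) ≤ 16 * 4 ^ Module.finrank ℝ F :=
    one_le_mul (by norm_num) (one_le_pow₀ (by norm_num))
  obtain ⟨c, hc0, hc⟩ : ∃ c : ℝ≥0∞, 0 < c ∧ c * (16 * 4 ^ Module.finrank ℝ F) < 1 :=
    ENNReal.exists_pos_mul_lt (by finiteness) one_ne_zero
  have hc1 : c < 1 := (le_mul_of_one_le_right' hK).trans_lt hc
  filter_upwards [ae_forall_mem_thinPoints_exists_notMem ν hE hc,
    ae_forall_mem_thinPoints_exists_notMem ν hE.compl hc] with z hzE hzEc a b hab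
  by_contra! hcon
  obtain ⟨⟨p, hp, hpE⟩, ⟨q, hq, hqE⟩⟩ := hcon
  have hPQ : {t ∈ uIcc p q | (t, z) ∈ zeroDensityPoints μ E} ∪
      {t ∈ uIcc p q | (t, z) ∈ zeroDensityPoints μ Eᶜ} = Icc (p ⊓ q) (p ⊔ q) := by
    rw [← sep_or]
    exact sep_eq_self_iff_mem_true.2 fun t ht => hab t (ordConnected_Ioo.uIcc_subset hp hq ht)
  have hcont : Continuous fun t : ℝ => (t, z) := by fun_prop
  have hdisj : ∀ (A : Set (ℝ × F)) (k : ℕ),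
      Disjoint ((fun t : ℝ => (t, z)) ⁻¹' thinPoints μ c A (1 / (k + 1)))
        {t ∈ uIcc p q | (t, z) ∈ zeroDensityPoints μ Aᶜ} := fun A k =>
    disjoint_left.2 fun t ht ht' => disjoint_left.1
      (disjoint_thinPoints_zeroDensityPoints_compl μ hc1 A Nat.one_div_pos_of_nat) ht ht'.2
  obtain ⟨ε, hε, ρ, hρ, k, x, hx⟩ := exists_one_sided_of_cover hPQ
    (fun k : ℕ => (isClosed_thinPoints μ c E (1 / (k + 1))).preimage hcont)
    (fun k : ℕ => (isClosed_thinPoints μ c Eᶜ (1 / (k + 1))).preimage hcont)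
    (fun t ht => by simpa using zeroDensityPoints_subset_iUnion_thinPoints μ hc0.ne' _ ht.2)
    (fun t ht => by simpa using zeroDensityPoints_subset_iUnion_thinPoints μ hc0.ne' _ ht.2)
    (hdisj E) (fun k => by simpa only [compl_compl] using hdisj Eᶜ k)
    ⟨q, right_mem_uIcc, (hab q hq).resolve_right hqE⟩
    ⟨p, left_mem_uIcc, (hab p hp).resolve_left hpE⟩
  have hmin : 0 < min ρ (1 / ((k : ℝ) + 1)) := lt_min hρ Nat.one_div_pos_of_nat
  rcases hx with ⟨hx, hs⟩ | ⟨hx, hs⟩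
  · obtain ⟨s, hs', hns⟩ := hzE _ hmin ε hε x (thinPoints_anti μ c E (min_le_right _ _) hx)
    exact hns (hs s (Ioo_subset_Ioo_right (min_le_left _ _) hs')).2
  · obtain ⟨s, hs', hns⟩ := hzEc _ hmin ε hε x (thinPoints_anti μ c Eᶜ (min_le_right _ _) hx)
    rw [compl_compl] at hns
    exact hns (hs s (Ioo_subset_Ioo_right (min_le_left _ _) hs')).2

theorem ae_forall_volume_Ioo_slice_eq_zero_or {E : Set (ℝ × F)} (hE : MeasurableSet E) :
    ∀ᵐ z ∂ν, ∀ a b : ℝ,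
      (∀ t ∈ Ioo a b, (t, z) ∈ zeroDensityPoints ((volume : Measure ℝ).prod ν) E ∪
        zeroDensityPoints ((volume : Measure ℝ).prod ν) Eᶜ) →
      volume {t ∈ Ioo a b | (t, z) ∈ E} = 0 ∨ volume {t ∈ Ioo a b | (t, z) ∉ E} = 0 := by
  set μ := (volume : Measure ℝ).prod ν
  have hswap := (Measure.measurePreserving_swap (μ := ν)
    (ν := (volume : Measure ℝ))).quasiMeasurePreserving.ae (ae_mem_zeroDensityPoints_iff μ hE)
  filter_upwards [ae_forall_Ioo_zeroDensityPoints_or ν hE,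
    Measure.ae_ae_of_ae_prod hswap] with z hz hzE a b hab
  refine (hz a b hab).imp (fun h => ?_) fun h => ?_
  · refine measure_eq_zero_iff_ae_notMem.2 (hzE.mono fun t ht ht' => ?_)
    exact ht.1.1 (h t ht'.1) ht'.2
  · refine measure_eq_zero_iff_ae_notMem.2 (hzE.mono fun t ht ht' => ?_)
    exact ht'.2 (ht.2.1 (h t ht'.1))

end Slicing

section Cube

open Function

variable {ι : Type*} [DecidableEq ι]

/-- The `μ`-fraction, on the line through `y` in the `i`-th coordinate direction, occupied by
`E`. -/
def lineFraction (μ : Measure ℝ) (E : Set (ι → ℝ)) (i : ι) (y : ι → ℝ) : ℝ≥0∞ :=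
  μ {s | update y i s ∈ E}

/-- The union of the lines in the `i`-th coordinate direction on which neither `E` nor its
complement is negligible. It stands in for the projection of the boundary of `E` along that
direction. -/
def mixedLines (μ : Measure ℝ) (E : Set (ι → ℝ)) (i : ι) : Set (ι → ℝ) :=
  {y | lineFraction μ E i y ≠ 0 ∧ lineFraction μ Eᶜ i y ≠ 0}

lemma mixedLines_compl (μ : Measure ℝ) (E : Set (ι → ℝ)) (i : ι) :
    mixedLines μ Eᶜ i = mixedLines μ E i := by
  simp [mixedLines, and_comm]

lemma lineFraction_update (μ : Measure ℝ) (E : Set (ι → ℝ)) (i : ι) (y : ι → ℝ) (s : ℝ) :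
    lineFraction μ E i (update y i s) = lineFraction μ E i y := by
  simp [lineFraction]

lemma lineFraction_eq_lintegral (μ : Measure ℝ) {E : Set (ι → ℝ)} (hE : MeasurableSet E) (i : ι)
    (y : ι → ℝ) : lineFraction μ E i y = ∫⁻ s, E.indicator 1 (update y i s) ∂μ := by
  have hm : MeasurableSet {s | update y i s ∈ E} := measurable_update y hE
  rw [lineFraction, ← lintegral_indicator_one hm]
  rfl

variable (μ : Measure ℝ)

lemma measurable_lineFraction [SigmaFinite μ] {E : Set (ι → ℝ)} (hE : MeasurableSet E) (i : ι) :
    Measurable (lineFraction μ E i) := by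
  simp_rw [funext (lineFraction_eq_lintegral μ hE i)]
  rw [← lmarginal_singleton (μ := fun _ : ι => μ) (E.indicator 1) i]
  exact (measurable_one.indicator hE).lmarginal _

lemma measurableSet_mixedLines [SigmaFinite μ] {E : Set (ι → ℝ)} (hE : MeasurableSet E) (i : ι) :
    MeasurableSet (mixedLines μ E i) :=
  (measurable_lineFraction μ hE i (measurableSet_singleton 0).compl).inter
    (measurable_lineFraction μ hE.compl i (measurableSet_singleton 0).compl)

variable [IsProbabilityMeasure μ] [Fintype ι]

lemma lintegral_lintegral_update (i : ι) {F : (ι → ℝ) → ℝ≥0∞} (hF : Measurable F) :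
    ∫⁻ y, ∫⁻ s, F (update y i s) ∂μ ∂(Measure.pi fun _ : ι => μ) =
      ∫⁻ y, F y ∂(Measure.pi fun _ : ι => μ) := by
  have h := lmarginal_singleton (μ := fun _ : ι => μ) F i
  refine lintegral_eq_of_lmarginal_eq {i} (h ▸ hF.lmarginal _) hF ?_
  rw [h, lmarginal_singleton]
  simp

lemma lintegral_lineFraction {E : Set (ι → ℝ)} (hE : MeasurableSet E) (i : ι) :
    ∫⁻ y, lineFraction μ E i y ∂(Measure.pi fun _ : ι => μ) = Measure.pi (fun _ : ι => μ) E := by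
  simp_rw [lineFraction_eq_lintegral μ hE]
  rw [lintegral_lintegral_update μ i (measurable_one.indicator hE), lintegral_indicator_one hE]

lemma ae_lineFraction_ne_zero {E : Set (ι → ℝ)} (hE : MeasurableSet E) (i : ι) :
    ∀ᵐ y ∂(Measure.pi fun _ : ι => μ), y ∈ E → lineFraction μ E i y ≠ 0 := by
  set B : Set (ι → ℝ) := E ∩ {y | lineFraction μ E i y = 0}
  have hB : MeasurableSet B := hE.inter (measurable_lineFraction μ hE i (measurableSet_singleton 0))
  have hB0 : Measure.pi (fun _ : ι => μ) B = 0 := by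
    rw [← lintegral_lineFraction μ hB i, lintegral_eq_zero_iff (measurable_lineFraction μ hB i)]
    refine Eventually.of_forall fun y => ?_
    by_cases hy : lineFraction μ E i y = 0
    · exact measure_mono_null (fun s hs => hs.1) hy
    · have hempty : {s | update y i s ∈ B} = ∅ := eq_empty_of_forall_notMem fun s hs =>
        hy (by simpa only [mem_ofPred_eq, lineFraction_update] using hs.2)
      simp [lineFraction, hempty]
  filter_upwards [measure_eq_zero_iff_ae_notMem.1 hB0] with y hyB hyE hy
  exact hyB ⟨hyE, hy⟩

lemma ae_lineFraction_le {E : Set (ι → ℝ)} (hE : MeasurableSet E) (i : ι) :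
    ∀ᵐ y ∂(Measure.pi fun _ : ι => μ), lineFraction μ E i y ≤
      E.indicator 1 y + (mixedLines μ E i).indicator 1 y := by
  filter_upwards [ae_lineFraction_ne_zero μ hE.compl i] with y hy
  have hle : lineFraction μ E i y ≤ 1 := prob_le_one
  by_cases hyE : y ∈ E
  · exact le_add_right (by simpa [hyE] using hle)
  by_cases h0 : lineFraction μ E i y = 0
  · simp [h0]
  · have hmem : y ∈ mixedLines μ E i := ⟨h0, hy hyE⟩
    exact le_add_left (by simpa [hmem] using hle)

lemma lintegral_indicator_mul_lintegral_update_le {E : Set (ι → ℝ)} (hE : MeasurableSet E) (k : ι)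
    {L : (ι → ℝ) → ℝ≥0∞} (hL : Measurable L) (hL1 : ∀ x, L x ≤ 1) :
    ∫⁻ x, E.indicator 1 x * ∫⁻ u, L (update x k u) ∂μ ∂(Measure.pi fun _ : ι => μ) ≤
      ∫⁻ x, E.indicator 1 x * L x ∂(Measure.pi fun _ : ι => μ) +
        Measure.pi (fun _ : ι => μ) (mixedLines μ E k) := by
  set π := Measure.pi fun _ : ι => μ
  have hEm : Measurable (E.indicator (1 : (ι → ℝ) → ℝ≥0∞)) := measurable_one.indicator hE
  have hLm : Measurable fun x => ∫⁻ u, L (update x k u) ∂μ := by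
    rw [← lmarginal_singleton (μ := fun _ : ι => μ)]
    exact hL.lmarginal _
  have hmixed := measurableSet_mixedLines μ hE k
  calc ∫⁻ x, E.indicator 1 x * ∫⁻ u, L (update x k u) ∂μ ∂π
      = ∫⁻ x, lineFraction μ E k x * ∫⁻ u, L (update x k u) ∂μ ∂π := by
        refine (lintegral_lintegral_update μ k (hEm.mul hLm)).symm.trans
          (lintegral_congr fun x => ?_)
        simp only [update_idem, Pi.mul_apply]
        rw [lineFraction_eq_lintegral μ hE]
        exact lintegral_mul_const _ (hEm.comp (measurable_update x))
    _ = ∫⁻ x, lineFraction μ E k x * L x ∂π := by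
        refine Eq.trans (lintegral_congr fun x => ?_)
          (lintegral_lintegral_update μ k ((measurable_lineFraction μ hE k).mul hL))
        simp only [lineFraction_update]
        exact (lintegral_const_mul _ (hL.comp (measurable_update x))).symm
    _ ≤ ∫⁻ x, (E.indicator 1 x * L x + (mixedLines μ E k).indicator 1 x) ∂π := by
        refine lintegral_mono_ae ?_
        filter_upwards [ae_lineFraction_le μ hE k] with x hx
        calc lineFraction μ E k x * L x
            ≤ (E.indicator 1 x + (mixedLines μ E k).indicator 1 x) * L x := by gcongr
          _ = E.indicator 1 x * L x + (mixedLines μ E k).indicator 1 x * L x := add_mul _ _ _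
          _ ≤ E.indicator 1 x * L x + (mixedLines μ E k).indicator 1 x := by
              gcongr
              exact mul_le_of_le_one_right' (hL1 x)
    _ = ∫⁻ x, E.indicator 1 x * L x ∂π + π (mixedLines μ E k) := by
        rw [lintegral_add_right _ (measurable_one.indicator hmixed), lintegral_indicator_one hmixed]

/-- A Poincaré inequality: averaging the indicator of `Eᶜ` over one coordinate at a time costs one
term of the sum per coordinate. -/
theorem measure_mul_measure_compl_le {E : Set (ι → ℝ)} (hE : MeasurableSet E) :
    Measure.pi (fun _ : ι => μ) E * Measure.pi (fun _ : ι => μ) Eᶜ ≤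
      ∑ i, Measure.pi (fun _ : ι => μ) (mixedLines μ E i) := by
  set π := Measure.pi fun _ : ι => μ with hπ
  set g : (ι → ℝ) → ℝ≥0∞ := Eᶜ.indicator 1
  have hg : Measurable g := measurable_one.indicator hE.compl
  have hle : ∀ s : Finset ι, ∀ x, (∫⋯∫⁻_s, g ∂fun _ => μ) x ≤ 1 := fun s x => by
    rw [lmarginal]
    refine (lintegral_mono (g := fun _ => 1) fun y => ?_).trans (by simp)
    exact indicator_le_self' (by simp) _
  have hsum : ∀ s : Finset ι, ∫⁻ x, E.indicator 1 x * (∫⋯∫⁻_s, g ∂fun _ => μ) x ∂π ≤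
      ∑ i ∈ s, π (mixedLines μ E i) := by
    intro s
    induction s using Finset.induction_on with
    | empty =>
      have hzero : ∀ x, E.indicator (1 : (ι → ℝ) → ℝ≥0∞) x * g x = 0 := fun x => by
        by_cases hx : x ∈ E <;> simp [g, hx]
      simp [hzero]
    | insert k s hk ih =>
      simp_rw [lmarginal_insert g hg hk]
      rw [Finset.sum_insert hk, add_comm (π _)]
      refine (lintegral_indicator_mul_lintegral_update_le μ hE k (hg.lmarginal _) (hle s)).trans ?_
      gcongr
  simpa only [lmarginal_univ, g, lintegral_indicator_one hE.compl, ← hπ,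
    lintegral_mul_const _ (measurable_one.indicator hE), lintegral_indicator_one hE]
    using hsum Finset.univ

lemma measure_lineFraction_ne_zero_le {E : Set (ι → ℝ)} (hE : MeasurableSet E) (i : ι) :
    Measure.pi (fun _ : ι => μ) {y | lineFraction μ E i y ≠ 0} ≤
      Measure.pi (fun _ : ι => μ) (mixedLines μ E i) + Measure.pi (fun _ : ι => μ) E := by
  have hmixed := measurableSet_mixedLines μ hE i
  have hne : MeasurableSet {y | lineFraction μ E i y ≠ 0} :=
    measurable_lineFraction μ hE i (measurableSet_singleton 0).compl
  rw [← lintegral_lineFraction μ hE i, ← lintegral_indicator_one hne,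
    ← lintegral_indicator_one hmixed, ← lintegral_add_left (measurable_one.indicator hmixed)]
  refine lintegral_mono fun y => ?_
  by_cases hy : lineFraction μ E i y = 0
  · simp [hy]
  by_cases hyc : lineFraction μ Eᶜ i y = 0
  · have hm : MeasurableSet {s | update y i s ∈ E} := measurable_update y hE
    have hone : lineFraction μ E i y = 1 := (prob_compl_eq_zero_iff hm).1 hyc
    simp [hone]
  · simp [mixedLines, hy, hyc]

lemma measure_le_lintegral_prod_rpow {E : Set (ι → ℝ)} (hE : MeasurableSet E) {q : ℝ}
    (hq : 0 < q) :
    Measure.pi (fun _ : ι => μ) E ≤ ∫⁻ x, ∏ i, (∫⁻ s, ∑ j,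
      {y | lineFraction μ E j y ≠ 0}.indicator 1 (update x i s) ∂μ) ^ q
        ∂(Measure.pi fun _ : ι => μ) := by
  rw [← lintegral_indicator_one hE]
  refine lintegral_mono_ae ?_
  filter_upwards [ae_all_iff.2 (ae_lineFraction_ne_zero μ hE)] with y hy
  by_cases hyE : y ∈ E
  swap
  · simp [hyE]
  rw [indicator_of_mem hyE, Pi.one_apply]
  refine Finset.one_le_prod' fun i _ => ENNReal.one_le_rpow ?_ hq
  calc (1 : ℝ≥0∞) = ∫⁻ _, 1 ∂μ := by simp
    _ ≤ _ := lintegral_mono fun s => ?_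
  have hmem : update y i s ∈ {y | lineFraction μ E i y ≠ 0} := by
    simpa only [mem_ofPred_eq, lineFraction_update] using hy i hyE
  calc (1 : ℝ≥0∞) = {y | lineFraction μ E i y ≠ 0}.indicator 1 (update y i s) := by
        rw [indicator_of_mem hmem, Pi.one_apply]
    _ ≤ _ := Finset.single_le_sum
        (f := fun j => {y | lineFraction μ E j y ≠ 0}.indicator (1 : (ι → ℝ) → ℝ≥0∞)
          (update y i s)) (fun _ _ => zero_le) (Finset.mem_univ i)

/-- A Loomis–Whitney inequality. -/
theorem measure_le_rpow {E : Set (ι → ℝ)} (hE : MeasurableSet E) {p : ℝ}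
    (hp : Real.HolderConjugate (Fintype.card ι) p) :
    Measure.pi (fun _ : ι => μ) E ≤
      (∑ i, Measure.pi (fun _ : ι => μ) (mixedLines μ E i) +
        Fintype.card ι * Measure.pi (fun _ : ι => μ) E) ^ p := by
  have hm : ∀ i, MeasurableSet {y | lineFraction μ E i y ≠ 0} := fun i =>
    measurable_lineFraction μ hE i (measurableSet_singleton 0).compl
  refine (measure_le_lintegral_prod_rpow μ hE (one_div_pos.2 (sub_pos.2 hp.lt))).trans
    ((lintegral_prod_lintegral_pow_le (fun _ : ι => μ) hp
      (Finset.measurable_sum _ fun i _ => measurable_one.indicator (hm i))).trans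
      (ENNReal.rpow_le_rpow ?_ hp.symm.nonneg))
  rw [lintegral_finsetSum _ fun i _ => measurable_one.indicator (hm i)]
  calc ∑ i, ∫⁻ y, {y | lineFraction μ E i y ≠ 0}.indicator 1 y ∂(Measure.pi fun _ : ι => μ)
      ≤ ∑ i, (Measure.pi (fun _ : ι => μ) (mixedLines μ E i) +
          Measure.pi (fun _ : ι => μ) E) := Finset.sum_le_sum fun i _ =>
        (lintegral_indicator_one (hm i)).trans_le (measure_lineFraction_ne_zero_le μ hE i)
    _ = _ := by simp [Finset.sum_add_distrib]

lemma one_le_sum_mixedLines [Subsingleton ι] {E : Set (ι → ℝ)} (hE : MeasurableSet E)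
    (h : Measure.pi (fun _ : ι => μ) E ≠ 0) (hc : Measure.pi (fun _ : ι => μ) Eᶜ ≠ 0) :
    1 ≤ ∑ i, Measure.pi (fun _ : ι => μ) (mixedLines μ E i) := by
  have hsum := (mul_ne_zero h hc).bot_lt.trans_le (measure_mul_measure_compl_le μ hE)
  obtain ⟨i, hi, hne⟩ := Finset.exists_ne_zero_of_sum_ne_zero hsum.ne'
  obtain ⟨y, hy⟩ := nonempty_of_measure_ne_zero hne
  have huniv : mixedLines μ E i = univ := eq_univ_of_forall fun y' => by
    have hupd : ∀ s, update y' i s = update y i s := fun s =>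
      funext fun j => by rw [Subsingleton.elim j i, update_self, update_self]
    simpa only [mixedLines, lineFraction, mem_ofPred_eq, hupd] using hy
  calc (1 : ℝ≥0∞) = Measure.pi (fun _ : ι => μ) (mixedLines μ E i) := by
        rw [huniv, measure_univ]
    _ ≤ _ := Finset.single_le_sum
        (f := fun j => Measure.pi (fun _ : ι => μ) (mixedLines μ E j)) (fun _ _ => zero_le) hi

lemma rpow_measure_le_sum_mixedLines [Nontrivial ι] {E : Set (ι → ℝ)} (hE : MeasurableSet E)
    (hhalf : Measure.pi (fun _ : ι => μ) E ≤ Measure.pi (fun _ : ι => μ) Eᶜ) :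
    Measure.pi (fun _ : ι => μ) E ^ (1 - (Fintype.card ι : ℝ)⁻¹) ≤
      (2 * Fintype.card ι + 1) * ∑ i, Measure.pi (fun _ : ι => μ) (mixedLines μ E i) := by
  set π := Measure.pi fun _ : ι => μ
  set S := ∑ i, π (mixedLines μ E i)
  have hn : (1 : ℝ) < Fintype.card ι := by exact_mod_cast Fintype.one_lt_card
  have hp := Real.HolderConjugate.conjExponent hn
  have hcompl : 1 ≤ 2 * π Eᶜ := by
    rw [two_mul, ← prob_add_prob_compl (μ := π) hE]
    gcongr
  have hpoincare : π E ≤ 2 * S := calc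
    π E ≤ π E * (2 * π Eᶜ) := le_mul_of_one_le_right' hcompl
    _ = 2 * (π E * π Eᶜ) := by ring
    _ ≤ 2 * S := by gcongr; exact measure_mul_measure_compl_le μ hE
  rw [hp.one_sub_inv, ← ENNReal.le_rpow_inv_iff (inv_pos.2 hp.symm.pos), inv_inv]
  refine (measure_le_rpow μ hE hp).trans (ENNReal.rpow_le_rpow ?_ hp.symm.nonneg)
  calc S + Fintype.card ι * π E ≤ S + Fintype.card ι * (2 * S) := by gcongr
    _ = (2 * Fintype.card ι + 1) * S := by ring

theorem exists_min_rpow_le_sum_mixedLines (ι : Type*) [DecidableEq ι] [Fintype ι] :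
    ∃ α : ℝ, 0 < α ∧ α < 1 ∧ ∀ (μ : Measure ℝ) [IsProbabilityMeasure μ] (E : Set (ι → ℝ)),
      MeasurableSet E →
        min (Measure.pi (fun _ : ι => μ) E) (Measure.pi (fun _ : ι => μ) Eᶜ) ^ α ≤
          (2 * Fintype.card ι + 1) * ∑ i, Measure.pi (fun _ : ι => μ) (mixedLines μ E i) := by
  rcases subsingleton_or_nontrivial ι with _ | _
  · refine ⟨2⁻¹, by norm_num, by norm_num, fun μ _ E hE => ?_⟩
    rcases eq_or_ne (min (Measure.pi (fun _ : ι => μ) E) (Measure.pi (fun _ : ι => μ) Eᶜ)) 0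
      with h0 | h0
    · simp [h0]
    calc _ ≤ (1 : ℝ≥0∞) := ENNReal.rpow_le_one ((min_le_left _ _).trans prob_le_one) (by norm_num)
      _ ≤ _ := one_le_mul le_add_self (one_le_sum_mixedLines μ hE
        (ne_bot_of_le_ne_bot h0 (min_le_left _ _)) (ne_bot_of_le_ne_bot h0 (min_le_right _ _)))
  · have hn : (1 : ℝ) < Fintype.card ι := by exact_mod_cast Fintype.one_lt_card
    refine ⟨1 - (Fintype.card ι : ℝ)⁻¹, sub_pos.2 (inv_lt_one_of_one_lt₀ hn),
      sub_lt_self _ (by positivity), fun μ _ E hE => ?_⟩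
    rcases le_total (Measure.pi (fun _ : ι => μ) E) (Measure.pi (fun _ : ι => μ) Eᶜ) with h | h
    · rw [min_eq_left h]
      exact rpow_measure_le_sum_mixedLines μ hE h
    · rw [min_eq_right h]
      simpa only [mixedLines_compl]
        using rpow_measure_le_sum_mixedLines μ hE.compl (by rwa [compl_compl])

end Cube

section Line

variable {ν : Measure ℝ}

lemma volume_le_of_forall_inter_Iio_le {A : Set ℝ} (hA : MeasurableSet A) {c : ℝ≥0∞}
    (h : ∀ t ∈ A, volume (A ∩ Iio t) ≤ c) : volume A ≤ c := by
  refine le_of_forall_lt fun r hr => ?_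
  obtain ⟨C, hCA, hC, hrC⟩ := hA.exists_lt_isCompact hr
  have hne : C.Nonempty := nonempty_of_measure_ne_zero (zero_le.trans_lt hrC).ne'
  obtain ⟨t, ht, hmax⟩ := hC.exists_isGreatest hne
  have hsub : C ⊆ A ∩ Iio t ∪ {t} := fun s hs =>
    (hmax hs).lt_or_eq.imp (fun hst => ⟨hCA hs, hst⟩) id
  calc r < volume C := hrC
    _ ≤ volume (A ∩ Iio t) + volume {t} := (measure_mono hsub).trans (measure_union_le _ _)
    _ ≤ c := by rw [measure_singleton, add_zero]; exact h t (hCA ht)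

lemma volume_le_of_forall_inter_Ioi_le {A : Set ℝ} (hA : MeasurableSet A) {c : ℝ≥0∞}
    (h : ∀ t ∈ A, volume (A ∩ Ioi t) ≤ c) : volume A ≤ c := by
  rw [← Measure.measure_neg]
  refine volume_le_of_forall_inter_Iio_le hA.neg fun t ht => ?_
  rw [← Measure.measure_neg, inter_neg, neg_neg, neg_Iio]
  exact h (-t) ht

lemma exists_lt_volume_inter_Iio_and_Ioi {A : Set ℝ} (hA : MeasurableSet A) {c : ℝ≥0∞}
    (h : 2 * c < volume A) : ∃ p, c < volume (A ∩ Iio p) ∧ c < volume (A ∩ Ioi p) := by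
  by_contra! hcon
  set D : Set ℝ := {p | volume (A ∩ Iio p) ≤ c}
  have hmono : Monotone fun p => volume (A ∩ Iio p) := fun p q hpq =>
    measure_mono (inter_subset_inter_right _ (Iio_subset_Iio hpq))
  have hD : MeasurableSet D := hmono.measurable measurableSet_Iic
  have hAD : volume (A ∩ D) ≤ c := volume_le_of_forall_inter_Iio_le (hA.inter hD) fun t ht =>
    (measure_mono (inter_subset_inter_left _ inter_subset_left)).trans ht.2
  have hADc : volume (A \ D) ≤ c := volume_le_of_forall_inter_Ioi_le (hA.diff hD) fun t ht =>
    (measure_mono (inter_subset_inter_left _ sdiff_subset)).trans (hcon t (not_le.1 ht.2))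
  refine h.not_ge ?_
  rw [two_mul]
  exact (measure_le_inter_add_sdiff _ _ _).trans (add_le_add hAD hADc)

/-- The constant in the growth estimate `volume_le_of_measure_Iio_lt`: the sum of the lengths
`2 ^ α * (2 ^ (α - 1)) ^ k` of the dyadic levels. -/
noncomputable def growthConst (α : ℝ) : ℝ≥0∞ :=
  2 ^ α * (1 - 2 ^ (α - 1))⁻¹

lemma growthConst_ne_top {α : ℝ} (hα : α < 1) : growthConst α ≠ ⊤ := by
  have h2 : (2 : ℝ≥0∞) ^ (α - 1) < 1 :=
    ENNReal.rpow_lt_one_of_one_lt_of_neg (by norm_num) (by linarith)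
  have h2α : (2 : ℝ≥0∞) ^ α ≠ ⊤ := by finiteness
  exact ENNReal.mul_ne_top h2α (ENNReal.inv_ne_top.2 (tsub_pos_of_lt h2).ne')

lemma exists_nat_mem_Ioc_inv_two_pow {x : ℝ≥0∞} (h0 : x ≠ 0) (h1 : x ≤ 1) :
    ∃ k : ℕ, x ∈ Ioc (2⁻¹ ^ (k + 1)) (2⁻¹ ^ k) := by
  lift x to NNReal using ne_top_of_le_ne_top ENNReal.one_ne_top h1
  obtain ⟨k, hk⟩ := exists_nat_pow_near_of_lt_one (x := x) (y := (2⁻¹ : NNReal))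
    (pos_iff_ne_zero.2 (by exact_mod_cast h0)) (by exact_mod_cast h1) (by norm_num)
    (inv_lt_one_of_one_lt₀ one_lt_two)
  refine ⟨k, ?_⟩
  rw [← ENNReal.coe_two]
  exact ⟨mod_cast hk.1, mod_cast hk.2⟩

lemma measurable_measure_Iio (ν : Measure ℝ) : Measurable fun t => ν (Iio t) :=
  Monotone.measurable fun _ _ hst => measure_mono (Iio_subset_Iio hst)

section Growth

variable {g : ℝ → ℝ≥0∞} {K : ℝ≥0∞} {α : ℝ} {X : Set ℝ}

lemma volume_setOf_measure_Iio_eq_zero (hg : Measurable g) (hα : 0 < α)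
    (hX : MeasurableSet X) (hlt : ∀ t ∈ X, ν (Iio t) < g t)
    (hK : ∀ T ⊆ X, MeasurableSet T → ∫⁻ t in T, g t ^ α ≤ K * ν T) :
    volume (X ∩ {t | ν (Iio t) = 0}) = 0 := by
  set X₀ : Set ℝ := X ∩ {t | ν (Iio t) = 0}
  have hX₀ : MeasurableSet X₀ := hX.inter (measurable_measure_Iio ν (measurableSet_singleton 0))
  refine nonpos_iff_eq_zero.1 (volume_le_of_forall_inter_Iio_le hX₀ fun t ht => ?_)
  have hm : MeasurableSet (X₀ ∩ Iio t) := hX₀.inter measurableSet_Iio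
  have hint : ∫⁻ s in X₀ ∩ Iio t, g s ^ α = 0 := by
    refine nonpos_iff_eq_zero.1 ((hK _ (inter_subset_left.trans inter_subset_left) hm).trans_eq ?_)
    rw [measure_mono_null inter_subset_right ht.2, mul_zero]
  rw [setLIntegral_eq_zero_iff hm (hg.pow_const α)] at hint
  refine (measure_eq_zero_iff_ae_notMem.2 (hint.mono fun s hs hsX => ?_)).le
  exact (ENNReal.rpow_pos_of_nonneg (zero_le.trans_lt (hlt s hsX.1.1)) hα.le).ne' (hs hsX)

lemma volume_setOf_measure_Iio_mem_Ioc_le (hα : 0 < α)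
    (hX : MeasurableSet X) (hlt : ∀ t ∈ X, ν (Iio t) < g t)
    (hK : ∀ T ⊆ X, MeasurableSet T → ∫⁻ t in T, g t ^ α ≤ K * ν T) (k : ℕ) :
    volume (X ∩ {t | ν (Iio t) ∈ Ioc (2⁻¹ ^ (k + 1)) (2⁻¹ ^ k)}) ≤
      K * (2 ^ α * (2 ^ (α - 1)) ^ k) := by
  set X₁ : Set ℝ := X ∩ {t | ν (Iio t) ∈ Ioc (2⁻¹ ^ (k + 1)) (2⁻¹ ^ k)}
  have hX₁ : MeasurableSet X₁ := hX.inter (measurable_measure_Iio ν measurableSet_Ioc)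
  refine volume_le_of_forall_inter_Iio_le hX₁ fun t ht => ?_
  have hm : MeasurableSet (X₁ ∩ Iio t) := hX₁.inter measurableSet_Iio
  have hle : (2⁻¹ ^ (k + 1)) ^ α * volume (X₁ ∩ Iio t) ≤ K * 2⁻¹ ^ k := calc
    (2⁻¹ ^ (k + 1)) ^ α * volume (X₁ ∩ Iio t) ≤ ∫⁻ s in X₁ ∩ Iio t, g s ^ α := by
        rw [← setLIntegral_const]
        exact setLIntegral_mono' hm fun s hs =>
          ENNReal.rpow_le_rpow (hs.1.2.1.le.trans (hlt s hs.1.1).le) hα.le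
    _ ≤ K * ν (X₁ ∩ Iio t) := hK _ (inter_subset_left.trans inter_subset_left) hm
    _ ≤ K * 2⁻¹ ^ k := by
        gcongr
        exact (measure_mono inter_subset_right).trans ht.2.2
  have hpow : (2⁻¹ ^ (k + 1) : ℝ≥0∞) ^ α * (2 ^ α * (2 ^ (α - 1)) ^ k) = 2⁻¹ ^ k := by
    rw [← ENNReal.rpow_neg_one]
    simp only [← ENNReal.rpow_natCast, ← ENNReal.rpow_mul]
    rw [← ENNReal.rpow_add _ _ two_ne_zero ENNReal.ofNat_ne_top,
      ← ENNReal.rpow_add _ _ two_ne_zero ENNReal.ofNat_ne_top]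
    congr 1
    push_cast
    ring
  rw [← hpow, mul_left_comm] at hle
  exact (ENNReal.mul_le_mul_iff_right (by simp) (by simp)).1 hle

/-- If `ν` grows no faster than `g ^ α` along `X`, but is smaller than `g` to the left of each point
of `X`, then it must reach mass one within a bounded length. -/
lemma volume_le_of_measure_Iio_lt (hν : ν univ ≤ 1) (hg : Measurable g) (hα : 0 < α)
    (hX : MeasurableSet X) (hlt : ∀ t ∈ X, ν (Iio t) < g t)
    (hK : ∀ T ⊆ X, MeasurableSet T → ∫⁻ t in T, g t ^ α ≤ K * ν T) :
    volume X ≤ K * growthConst α := by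
  set level : ℕ → Set ℝ := fun k => {t | ν (Iio t) ∈ Ioc (2⁻¹ ^ (k + 1)) (2⁻¹ ^ k)}
  have hcover : X ⊆ X ∩ {t | ν (Iio t) = 0} ∪ ⋃ k, X ∩ level k := by
    intro t ht
    by_cases h0 : ν (Iio t) = 0
    · exact Or.inl ⟨ht, h0⟩
    · obtain ⟨k, hk⟩ := exists_nat_mem_Ioc_inv_two_pow h0 ((measure_mono (subset_univ _)).trans hν)
      exact Or.inr (mem_iUnion.2 ⟨k, ht, hk⟩)
  calc volume X ≤ volume (X ∩ {t | ν (Iio t) = 0}) + ∑' k, volume (X ∩ level k) :=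
        (measure_mono hcover).trans ((measure_union_le _ _).trans
          (add_le_add_right (measure_iUnion_le _) _))
    _ ≤ 0 + ∑' k : ℕ, K * (2 ^ α * (2 ^ (α - 1)) ^ k) := add_le_add
        (volume_setOf_measure_Iio_eq_zero hg hα hX hlt hK).le
        (ENNReal.tsum_le_tsum (volume_setOf_measure_Iio_mem_Ioc_le hα hX hlt hK))
    _ = K * growthConst α := by
        rw [zero_add, ENNReal.tsum_mul_left, ENNReal.tsum_mul_left, ENNReal.tsum_geometric,
          growthConst]

lemma volume_le_of_measure_Ioi_lt (hν : ν univ ≤ 1) (hg : Measurable g) (hα : 0 < α)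
    (hX : MeasurableSet X) (hlt : ∀ t ∈ X, ν (Ioi t) < g t)
    (hK : ∀ T ⊆ X, MeasurableSet T → ∫⁻ t in T, g t ^ α ≤ K * ν T) :
    volume X ≤ K * growthConst α := by
  rw [← Measure.measure_neg]
  refine volume_le_of_measure_Iio_lt (ν := ν.map Neg.neg) (g := fun t => g (-t)) ?_
    (hg.comp measurable_neg) hα hX.neg (fun t ht => ?_) fun T hT hTm => ?_
  · rwa [Measure.map_apply measurable_neg .univ, preimage_univ]
  · rw [Measure.map_apply measurable_neg measurableSet_Iio]
    simpa using hlt (-t) ht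
  · rw [Measure.map_apply measurable_neg hTm]
    refine le_trans (le_of_eq ?_) (hK (-T) (neg_subset.2 hT) hTm.neg)
    simpa using ((Measure.measurePreserving_neg (volume : Measure ℝ)).setLIntegral_comp_preimage_emb
      (MeasurableEquiv.neg ℝ).measurableEmbedding (fun t => g t ^ α) (-T))

end Growth

section Crossing

variable {f g : ℝ → ℝ≥0∞} {K : ℝ≥0∞} {α : ℝ} {S : Set ℝ}

lemma volume_le_or_volume_le_of_forall_lt {X Y : Set ℝ} (hν : ν univ < 1) (hg : Measurable g)
    (hα : 0 < α) (hX : MeasurableSet X) (hY : MeasurableSet Y)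
    (hK : ∀ T ⊆ X ∪ Y, MeasurableSet T → ∫⁻ t in T, g t ^ α ≤ K * ν T)
    (hXY : ∀ s ∈ X, ∀ t ∈ Y, s < t ∧ 1 ≤ g s + ν (Icc s t) + g t) :
    volume X ≤ K * growthConst α ∨ volume Y ≤ K * growthConst α := by
  by_contra! hcon
  obtain ⟨s, hs, hgs⟩ : ∃ s ∈ X, g s ≤ ν (Iio s) := by
    by_contra! h
    exact hcon.1.not_ge (volume_le_of_measure_Iio_lt hν.le hg hα hX h fun T hT =>
      hK T (hT.trans subset_union_left))
  obtain ⟨t, ht, hgt⟩ : ∃ t ∈ Y, g t ≤ ν (Ioi t) := by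
    by_contra! h
    exact hcon.2.not_ge (volume_le_of_measure_Ioi_lt hν.le hg hα hY h fun T hT =>
      hK T (hT.trans subset_union_right))
  obtain ⟨hst, hone⟩ := hXY s hs t ht
  refine hν.not_ge ?_
  calc 1 ≤ g s + ν (Icc s t) + g t := hone
    _ ≤ ν (Iio s) + ν (Icc s t) + ν (Ioi t) := by gcongr
    _ = ν (Iic t) + ν (Ioi t) := by
        rw [← Iio_union_Icc_eq_Iic hst.le, measure_union _ measurableSet_Icc]
        exact disjoint_left.2 fun x hx hx' => hx'.1.not_gt hx
    _ = ν univ := by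
        rw [← compl_Iic, measure_add_measure_compl measurableSet_Iic]

lemma min_volume_le_of_forall_one_le {A B : Set ℝ} (hν : ν univ < 1) (hg : Measurable g)
    (hα : 0 < α) (hA : MeasurableSet A) (hB : MeasurableSet B)
    (hK : ∀ T ⊆ A ∪ B, MeasurableSet T → ∫⁻ t in T, g t ^ α ≤ K * ν T)
    (hAB : ∀ s ∈ A, ∀ t ∈ B, 1 ≤ g s + ν (uIcc s t) + g t) :
    min (volume A) (volume B) ≤ 2 * (K * growthConst α) := by
  refine min_le_iff.2 (or_iff_not_imp_left.2 fun hAW => ?_)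
  obtain ⟨p, hpl, hpr⟩ := exists_lt_volume_inter_Iio_and_Ioi hA (not_le.1 hAW)
  have hBA : ∀ t ∈ B, ∀ s ∈ A, 1 ≤ g t + ν (uIcc t s) + g s := fun t ht s hs => by
    rw [uIcc_comm, add_right_comm, add_comm (g t), add_right_comm]
    exact hAB s hs t ht
  have hBr : volume (B ∩ Ioi p) ≤ K * growthConst α := by
    refine (volume_le_or_volume_le_of_forall_lt hν hg hα (hA.inter measurableSet_Iio)
      (hB.inter measurableSet_Ioi) (fun T hT => hK T (hT.trans ?_))
      fun s hs t ht => ?_).resolve_left hpl.not_ge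
    · exact union_subset_union inter_subset_left inter_subset_left
    · have hst : s < t := lt_trans hs.2 ht.2
      exact ⟨hst, uIcc_of_lt hst ▸ hAB s hs.1 t ht.1⟩
  have hBl : volume (B ∩ Iio p) ≤ K * growthConst α := by
    refine (volume_le_or_volume_le_of_forall_lt hν hg hα (hB.inter measurableSet_Iio)
      (hA.inter measurableSet_Ioi) (fun T hT => hK T (hT.trans ?_))
      fun t ht s hs => ?_).resolve_right hpr.not_ge
    · exact union_comm A B ▸ union_subset_union inter_subset_left inter_subset_left
    · have hts : t < s := lt_trans ht.2 hs.2
      exact ⟨hts, uIcc_of_lt hts ▸ hBA t ht.1 s hs.1⟩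
  calc volume B = volume (B ∩ Iio p) + volume (B \ Iio p) :=
        (measure_inter_add_sdiff _ measurableSet_Iio).symm
    _ = volume (B ∩ Iio p) + volume (B ∩ Ioi p) := by
        rw [sdiff_eq, compl_Iio, measure_congr ((ae_eq_refl B).inter Ioi_ae_eq_Ici)]
    _ ≤ 2 * (K * growthConst α) := (add_le_add hBl hBr).trans_eq (two_mul _).symm

/-- If both alternatives occur, `f` is close to neither `0` nor `1` anywhere on `S`, so the whole of
`S` contributes to the boundary. -/
lemma one_le_four_mul_of_exists (hK1 : 1 ≤ K) (hα : 0 < α) (hα1 : α ≤ 1) (hS : MeasurableSet S)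
    (hS1 : 1 ≤ volume S) (hK : ∫⁻ t in S, min (f t) (1 - f t) ^ α ≤ K * ν univ)
    (hf : ∀ s ∈ S, ∀ t ∈ S, f s ≤ f t + ν univ) {s t : ℝ} (hs : s ∈ S) (ht : t ∈ S)
    (hfs : f s ≤ 2⁻¹) (hft : 2⁻¹ ≤ f t) : 1 ≤ 4 * (K * ν univ) := by
  rw [← ENNReal.inv_le_iff_le_mul (by simp) (by simp)]
  rcases le_total 4⁻¹ (ν univ) with hν | hν
  · exact hν.trans (le_mul_of_one_le_left' hK1)
  have hquarter : (4⁻¹ : ℝ≥0∞) + 4⁻¹ = 2⁻¹ := by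
    rw [← two_mul, show (4 : ℝ≥0∞) = 2 * 2 by norm_num, ENNReal.mul_inv (by simp) (by simp),
      ← mul_assoc, ENNReal.mul_inv_cancel (by simp) (by simp), one_mul]
  have hlow : ∀ r ∈ S, 4⁻¹ ≤ f r := fun r hr => by
    rw [← ENNReal.add_le_add_iff_right (show (4⁻¹ : ℝ≥0∞) ≠ ⊤ by simp), hquarter]
    exact hft.trans ((hf t ht r hr).trans (by gcongr))
  have hhigh : ∀ r ∈ S, 4⁻¹ + f r ≤ 1 := fun r hr => calc
    4⁻¹ + f r ≤ 4⁻¹ + (2⁻¹ + 4⁻¹) := by gcongr; exact (hf r hr s hs).trans (by gcongr)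
    _ = 1 := by rw [add_left_comm, hquarter, ENNReal.inv_two_add_inv_two]
  have hmem : ∀ r ∈ S, 4⁻¹ ≤ min (f r) (1 - f r) := fun r hr =>
    le_min (hlow r hr) (ENNReal.le_sub_of_add_le_right
      (ne_top_of_le_ne_top ENNReal.one_ne_top (le_add_self.trans (hhigh r hr))) (hhigh r hr))
  calc 4⁻¹ ≤ 4⁻¹ * volume S := le_mul_of_one_le_right' hS1
    _ = ∫⁻ _ in S, 4⁻¹ := (setLIntegral_const S _).symm
    _ ≤ ∫⁻ r in S, min (f r) (1 - f r) ^ α := setLIntegral_mono' hS fun r hr => calc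
        (4⁻¹ : ℝ≥0∞) = 4⁻¹ ^ (1 : ℝ) := (ENNReal.rpow_one _).symm
        _ ≤ 4⁻¹ ^ α := ENNReal.rpow_le_rpow_of_exponent_ge (by simp) hα1
        _ ≤ min (f r) (1 - f r) ^ α := ENNReal.rpow_le_rpow (hmem r hr) hα.le
    _ ≤ K * ν univ := hK

lemma setLIntegral_le_add_volume_sdiff {h : ℝ → ℝ≥0∞} {c : ℝ≥0∞} {T : Set ℝ} (hα1 : α ≤ 1)
    (hT : MeasurableSet T) (hTS : T ⊆ S) (hh : ∀ t, h t ≤ 1) (hhg : ∀ t ∈ T, h t ≤ g t)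
    (hg1 : ∀ t, g t ≤ 1) (hc : ∫⁻ t in T, g t ^ α ≤ c) :
    ∫⁻ t in S, h t ≤ c + volume (S \ T) := by
  rw [← lintegral_inter_add_sdiff _ S hT, inter_eq_right.2 hTS]
  refine add_le_add ((setLIntegral_mono' hT fun t ht => ?_).trans hc) ?_
  · calc h t ≤ g t ^ (1 : ℝ) := (hhg t ht).trans_eq (ENNReal.rpow_one _).symm
      _ ≤ g t ^ α := ENNReal.rpow_le_rpow_of_exponent_ge (hg1 t) hα1
  · exact (lintegral_mono hh).trans (setLIntegral_one _).le

lemma le_min_one_sub {x : ℝ≥0∞} (hx : x ≤ 2⁻¹) : x ≤ min x (1 - x) :=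
  le_min le_rfl (ENNReal.le_sub_of_add_le_left (ne_top_of_le_ne_top (by simp) hx)
    ((add_le_add hx hx).trans_eq ENNReal.inv_two_add_inv_two))

lemma one_sub_le_min {x : ℝ≥0∞} (hx : 2⁻¹ ≤ x) : 1 - x ≤ min x (1 - x) :=
  le_min (tsub_le_iff_right.2 (ENNReal.inv_two_add_inv_two.symm.trans_le (add_le_add hx hx))) le_rfl

lemma min_volume_levelSets_le (hν : ν univ < 1) (hf : Measurable f) (hK1 : 1 ≤ K) (hα : 0 < α)
    (hα1 : α ≤ 1) (hS : MeasurableSet S) (hS1 : 1 ≤ volume S)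
    (hK : ∀ T ⊆ S, MeasurableSet T → ∫⁻ t in T, min (f t) (1 - f t) ^ α ≤ K * ν T)
    (hfS : ∀ s ∈ S, ∀ t ∈ S, f s ≤ f t + ν (uIcc s t)) :
    min (volume (S ∩ {t | f t ≤ 2⁻¹})) (volume (S ∩ {t | 2⁻¹ < f t})) ≤
      8 * K ^ 2 * growthConst α * ν univ := by
  set A : Set ℝ := S ∩ {t | f t ≤ 2⁻¹}
  set B : Set ℝ := S ∩ {t | 2⁻¹ < f t}
  rcases A.eq_empty_or_nonempty with hA | ⟨s, hs⟩
  · simp [hA]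
  rcases B.eq_empty_or_nonempty with hB | ⟨t, ht⟩
  · simp [hB]
  have hone : 1 ≤ 4 * (K * ν univ) :=
    one_le_four_mul_of_exists hK1 hα hα1 hS hS1
      ((hK S subset_rfl hS).trans (by gcongr; exact subset_univ S))
      (fun s hs t ht => (hfS s hs t ht).trans (by gcongr; exact subset_univ _))
      hs.1 ht.1 hs.2 ht.2.le
  have hAB : ∀ s ∈ A, ∀ t ∈ B, 1 ≤ min (f s) (1 - f s) + ν (uIcc s t) + min (f t) (1 - f t) :=
    fun s hs t ht => calc
      1 ≤ f t + (1 - f t) := le_add_tsub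
      _ ≤ f s + ν (uIcc s t) + (1 - f t) := by
        gcongr
        exact uIcc_comm s t ▸ hfS t ht.1 s hs.1
      _ ≤ min (f s) (1 - f s) + ν (uIcc s t) + min (f t) (1 - f t) := by
        gcongr
        exacts [le_min_one_sub hs.2, one_sub_le_min ht.2.le]
  calc min (volume A) (volume B) ≤ 2 * (K * growthConst α) :=
        min_volume_le_of_forall_one_le hν (hf.min (measurable_const.sub hf)) hα
          (hS.inter (hf measurableSet_Iic)) (hS.inter (hf measurableSet_Ioi))
          (fun T hT => hK T (hT.trans (union_subset inter_subset_left inter_subset_left))) hAB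
    _ ≤ 2 * (K * growthConst α) * (4 * (K * ν univ)) := le_mul_of_one_le_right' hone
    _ = 8 * K ^ 2 * growthConst α * ν univ := by ring

/-- The one-dimensional core of the argument. It is applied to the volume fractions `f t` of the
slices orthogonal to the long direction, with `ν` the distribution of the boundary along it. -/
theorem min_setLIntegral_le (hν : ν univ < 1) (hf : Measurable f) (hf1 : ∀ t, f t ≤ 1)
    (hK1 : 1 ≤ K) (hα : 0 < α) (hα1 : α ≤ 1) (hS : MeasurableSet S) (hS1 : 1 ≤ volume S)
    (hK : ∀ T ⊆ S, MeasurableSet T → ∫⁻ t in T, min (f t) (1 - f t) ^ α ≤ K * ν T)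
    (hfS : ∀ s ∈ S, ∀ t ∈ S, f s ≤ f t + ν (uIcc s t)) :
    min (∫⁻ t in S, f t) (∫⁻ t in S, (1 - f t)) ≤ (K + 8 * K ^ 2 * growthConst α) * ν univ := by
  have hg1 : ∀ t, min (f t) (1 - f t) ≤ 1 := fun t => (min_le_left _ _).trans (hf1 t)
  have hKν : ∀ T ⊆ S, MeasurableSet T → ∫⁻ t in T, min (f t) (1 - f t) ^ α ≤ K * ν univ :=
    fun T hT hTm => (hK T hT hTm).trans (by gcongr; exact subset_univ T)
  have hA : MeasurableSet (S ∩ {t | f t ≤ 2⁻¹}) := hS.inter (hf measurableSet_Iic)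
  have hB : MeasurableSet (S ∩ {t | 2⁻¹ < f t}) := hS.inter (hf measurableSet_Ioi)
  have hAB : S \ (S ∩ {t | f t ≤ 2⁻¹}) = S ∩ {t | 2⁻¹ < f t} := by
    rw [sdiff_self_inter, sdiff_eq, compl_ofPred]
    simp only [not_le]
  have hBA : S \ (S ∩ {t | 2⁻¹ < f t}) = S ∩ {t | f t ≤ 2⁻¹} := by
    rw [sdiff_self_inter, sdiff_eq, compl_ofPred]
    simp only [not_lt]
  have hint := setLIntegral_le_add_volume_sdiff hα1 hA inter_subset_left hf1
    (fun t ht => le_min_one_sub ht.2) hg1 (hKν _ inter_subset_left hA)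
  have hintc := setLIntegral_le_add_volume_sdiff hα1 hB inter_subset_left (fun _ => tsub_le_self)
    (fun t ht => one_sub_le_min (le_of_lt ht.2)) hg1 (hKν _ inter_subset_left hB)
  rw [hAB] at hint
  rw [hBA] at hintc
  calc _ ≤ K * ν univ +
        min (volume (S ∩ {t | 2⁻¹ < f t})) (volume (S ∩ {t | f t ≤ 2⁻¹})) :=
        (min_le_min hint hintc).trans_eq (min_add_add_left _ _ _)
    _ ≤ K * ν univ + 8 * K ^ 2 * growthConst α * ν univ := by
        rw [min_comm]
        gcongr
        exact min_volume_levelSets_le hν hf hK1 hα hα1 hS hS1 hK hfS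
    _ = _ := (add_mul _ _ _).symm

lemma exists_rat_uIcc_subset_Ioo {V : Set ℝ} (hV : IsOpen V) {s t : ℝ} (h : uIcc s t ⊆ V) :
    ∃ a b : ℚ, uIcc s t ⊆ Ioo (a : ℝ) b ∧ Ioo (a : ℝ) b ⊆ V := by
  obtain ⟨a', ha', haV⟩ := exists_Ioc_subset_of_mem_nhds
    (hV.mem_nhds (h ⟨le_rfl, inf_le_sup⟩)) (exists_lt _)
  obtain ⟨b', hb', hbV⟩ := exists_Ico_subset_of_mem_nhds
    (hV.mem_nhds (h ⟨inf_le_sup, le_rfl⟩)) (exists_gt _)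
  obtain ⟨a, haa, has⟩ := exists_rat_btwn ha'
  obtain ⟨b, hbt, hbb⟩ := exists_rat_btwn hb'
  refine ⟨a, b, fun x hx => ⟨has.trans_le hx.1, hx.2.trans_lt hbt⟩, fun x hx => ?_⟩
  rcases le_total x (s ⊓ t) with hxs | hxs
  · exact haV ⟨haa.trans hx.1, hxs⟩
  rcases le_total (s ⊔ t) x with hxt | hxt
  · exact hbV ⟨hxt, hx.2.trans hbb⟩
  · exact h ⟨hxs, hxt⟩

lemma exists_measurableSet_forall_le_add_measure_uIcc [IsFiniteMeasure ν] {L : Set ℝ}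
    (hL : IsOpen L) [L.OrdConnected]
    (h : ∀ a b, Ioo a b ⊆ L → ∃ c, ∀ᵐ t, t ∈ Ioo a b → f t ∈ Icc c (c + ν (Ioo a b))) :
    ∃ S ⊆ L, MeasurableSet S ∧ volume (L \ S) = 0 ∧
      ∀ s ∈ S, ∀ t ∈ S, f s ≤ f t + ν (uIcc s t) := by
  have hae : ∀ᵐ t, ∀ a b : ℚ, ∀ hab : Ioo (a : ℝ) b ⊆ L, t ∈ Ioo (a : ℝ) b →
      f t ∈ Icc (h a b hab).choose ((h a b hab).choose + ν (Ioo (a : ℝ) b)) := by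
    simp only [ae_all_iff]
    exact fun a b hab => (h a b hab).choose_spec
  obtain ⟨N, hN, hNm, hN0⟩ := exists_measurable_superset_of_null (ae_iff.1 hae)
  refine ⟨L \ N, sdiff_subset, hL.measurableSet.diff hNm,
    measure_mono_null (fun t ht => by_contra fun htN => ht.2 ⟨ht.1, htN⟩) hN0,
    fun s hs t ht => le_of_forall_gt fun r hr => ?_⟩
  obtain ⟨U, hstU, hU, hνU⟩ := (uIcc s t).exists_isOpen_lt_of_lt _ (lt_tsub_iff_left.2 hr)
  obtain ⟨a, b, hst, hab⟩ := exists_rat_uIcc_subset_Ioo (hU.inter hL)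
    (subset_inter hstU (OrdConnected.uIcc_subset ‹_› hs.1 ht.1))
  have hmem : ∀ r ∈ L \ N, r ∈ Ioo (a : ℝ) b → f r ∈ Icc _ _ := fun r hr =>
    (not_not.1 (mt (@hN r) hr.2)) a b (hab.trans inter_subset_right)
  calc f s ≤ _ + ν (Ioo (a : ℝ) b) := (hmem s hs (hst left_mem_uIcc)).2
    _ ≤ f t + ν U := add_le_add (hmem t ht (hst right_mem_uIcc)).1
        (measure_mono (hab.trans inter_subset_left))
    _ < r := lt_tsub_iff_left.1 hνU

end Crossing

end Line

section Box

open Function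

variable {n : ℕ}

/-- `ℝ ^ (n + 1)` as a family of lines in the `j`-th coordinate direction: the first component is
the position on the line, the second one its base point. -/
def insertCoord (j : Fin (n + 1)) : ℝ × (Fin n → ℝ) ≃ᵐ (Fin (n + 1) → ℝ) :=
  (MeasurableEquiv.piFinSuccAbove (fun _ => ℝ) j).symm

lemma insertCoord_apply (j : Fin (n + 1)) (s : ℝ) (z : Fin n → ℝ) :
    insertCoord j (s, z) = j.insertNth (α := fun _ => ℝ) s z := rfl

lemma update_insertCoord (j : Fin (n + 1)) (s t : ℝ) (z : Fin n → ℝ) :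
    update (insertCoord j (s, z)) j t = insertCoord j (t, z) := by
  simp [insertCoord_apply]

lemma update_insertCoord_zero (t : ℝ) (y : Fin n → ℝ) (i : Fin n) (s : ℝ) :
    update (insertCoord 0 (t, y)) i.succ s = insertCoord 0 (t, update y i s) := by
  simp [insertCoord_apply]

lemma volume_preimage_insertCoord (j : Fin (n + 1)) (A : Set (Fin (n + 1) → ℝ)) :
    volume (insertCoord j ⁻¹' A) = volume A :=
  (volume_preserving_piFinSuccAbove (fun _ => ℝ) j).symm.measure_preimage_equiv A

lemma insertCoord_preimage_pi (j : Fin (n + 1)) (S : Fin (n + 1) → Set ℝ) :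
    insertCoord j ⁻¹' univ.pi S = S j ×ˢ univ.pi (j.removeNth S) := by
  ext ⟨s, z⟩
  simp [insertCoord_apply, Set.mem_pi, Fin.forall_iff_succAbove j, Fin.removeNth]

/-- The sides of the box with long side `T` and unit cross-section centred at the origin. -/
def sides (T : Set ℝ) : Fin (n + 1) → Set ℝ :=
  Fin.cons T fun _ => Ioo (-(1 / 2)) (1 / 2)

lemma measurableSet_sides {T : Set ℝ} (hT : MeasurableSet T) (i : Fin (n + 1)) :
    MeasurableSet (sides T i) :=
  Fin.cases hT (fun _ => measurableSet_Ioo) i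

/-- The box with long side `T` and unit cross-section centred at the origin; after rescaling, the
cuboids of the theorem take this form. -/
def box (n : ℕ) (T : Set ℝ) : Set (Fin (n + 1) → ℝ) :=
  univ.pi (sides T)

lemma box_mono {T T' : Set ℝ} (h : T ⊆ T') : box n T ⊆ box n T' :=
  pi_mono fun i _ => Fin.cases h (fun _ => subset_rfl) i

lemma box_subset_preimage (T : Set ℝ) : box n T ⊆ (fun x => x 0) ⁻¹' T :=
  fun _ hx => hx 0 (mem_univ 0)

/-- The slice of `E` at first coordinate `t`. -/
def slice (E : Set (Fin (n + 1) → ℝ)) (t : ℝ) : Set (Fin n → ℝ) :=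
  {y | insertCoord 0 (t, y) ∈ E}

lemma measurableSet_slice {E : Set (Fin (n + 1) → ℝ)} (hE : MeasurableSet E) (t : ℝ) :
    MeasurableSet (slice E t) :=
  measurable_prodMk_left ((insertCoord 0).measurable hE)

lemma slice_mixedLines_succ (μ : Measure ℝ) (E : Set (Fin (n + 1) → ℝ)) (i : Fin n) (t : ℝ) :
    slice (mixedLines μ E i.succ) t = mixedLines μ (slice E t) i := by
  simp only [slice, mixedLines, lineFraction, mem_ofPred_eq, mem_compl_iff, update_insertCoord_zero]

lemma slice_mixedLines_zero (μ : Measure ℝ) (E : Set (Fin (n + 1) → ℝ)) (t : ℝ) :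
    slice (mixedLines μ E 0) t =
      {y | μ {s | y ∈ slice E s} ≠ 0 ∧ μ {s | y ∉ slice E s} ≠ 0} := by
  simp only [slice, mixedLines, lineFraction, mem_ofPred_eq, mem_compl_iff, update_insertCoord]

lemma ae_fullLines_ae_le_slice (μ : Measure ℝ) [SFinite μ] (π : Measure (Fin n → ℝ)) [SFinite π]
    {E : Set (Fin (n + 1) → ℝ)} (hE : MeasurableSet E) :
    ∀ᵐ t ∂μ, {y | μ {s | y ∉ slice E s} = 0} ≤ᵐ[π] slice E t := by
  have hEm : MeasurableSet {q : ℝ × (Fin n → ℝ) | q.2 ∈ slice E q.1} :=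
    (insertCoord 0).measurable hE
  have hfull : MeasurableSet {y | μ {s | y ∉ slice E s} = 0} :=
    measurable_measure_prodMk_right hEm.compl (measurableSet_singleton 0)
  refine (Measure.ae_ae_comm ((measurable_snd hfull).imp hEm)).2 (Eventually.of_forall fun y => ?_)
  exact eventually_imp_distrib_left.2 fun hy => ae_iff.2 hy

lemma ae_slice_ae_le (μ : Measure ℝ) [SFinite μ] (π : Measure (Fin n → ℝ)) [SFinite π]
    {E : Set (Fin (n + 1) → ℝ)} (hE : MeasurableSet E) :
    ∀ᵐ t ∂μ, {y | μ {s | y ∉ slice E s} = 0} ≤ᵐ[π] slice E t ∧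
      slice E t ≤ᵐ[π]
        ({y | μ {s | y ∉ slice E s} = 0} ∪ slice (mixedLines μ E 0) t : Set (Fin n → ℝ)) := by
  filter_upwards [ae_fullLines_ae_le_slice μ π hE, ae_fullLines_ae_le_slice μ π hE.compl]
    with t hfull hnull
  refine ⟨hfull, hnull.mono fun y hy hyE => or_iff_not_imp_left.2 fun hyF => ?_⟩
  rw [slice_mixedLines_zero]
  refine ⟨fun h => hy (?_ : μ {s | y ∉ slice Eᶜ s} = 0) hyE, hyF⟩
  exact (measure_mono_null fun s hs => not_not.1 hs) h

/-- Lebesgue measure on the unit interval centred at the origin. -/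
noncomputable def unitMeasure : Measure ℝ :=
  volume.restrict (Ioo (-(1 / 2)) (1 / 2))

instance : IsProbabilityMeasure unitMeasure :=
  ⟨by rw [unitMeasure, Measure.restrict_apply_univ, Real.volume_Ioo]; norm_num⟩

/-- The uniform distribution on the cross-section of the boxes. -/
noncomputable abbrev cubeMeasure (n : ℕ) : Measure (Fin n → ℝ) :=
  Measure.pi fun _ => unitMeasure

lemma cubeMeasure_eq_restrict (T : Set ℝ) :
    cubeMeasure n = volume.restrict (univ.pi ((0 : Fin (n + 1)).removeNth (sides T))) := by
  rw [volume_pi, Measure.restrict_pi_pi]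
  rfl

lemma measurable_cubeMeasure_slice {E : Set (Fin (n + 1) → ℝ)} (hE : MeasurableSet E) :
    Measurable fun t => cubeMeasure n (slice E t) :=
  measurable_measure_prodMk_left ((insertCoord 0).measurable hE)

lemma setLIntegral_cubeMeasure_slice {E : Set (Fin (n + 1) → ℝ)} (hE : MeasurableSet E)
    (T : Set ℝ) : ∫⁻ t in T, cubeMeasure n (slice E t) = volume (E ∩ box n T) := by
  have hEm : MeasurableSet (insertCoord 0 ⁻¹' E) := (insertCoord 0).measurable hE
  rw [← volume_preimage_insertCoord 0, preimage_inter, box, insertCoord_preimage_pi,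
    ← Measure.restrict_apply hEm, Measure.volume_eq_prod, ← Measure.prod_restrict,
    Measure.prod_apply hEm, ← cubeMeasure_eq_restrict T]
  rfl

/-- The measure `ν` dominates the mixed lines of `E` in the box with long side `(-l, l)`. For the
Hausdorff measure on the essential boundary of `E` this expresses that each mixed line meets the
boundary and that projections do not increase the Hausdorff measure. -/
def ControlsMixedLines (ν : Measure (Fin (n + 1) → ℝ)) (E : Set (Fin (n + 1) → ℝ)) (l : ℝ) :
    Prop :=
  ∀ (j : Fin (n + 1)) (a b : ℝ) (S : Fin (n + 1) → Set ℝ), (∀ i, MeasurableSet (S i)) →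
    S j = Ioo a b → univ.pi S ⊆ box n (Ioo (-l) l) →
    volume (mixedLines (volume.restrict (Ioo a b)) E j ∩ univ.pi S) ≤
      ENNReal.ofReal (b - a) * ν (univ.pi S)

variable {ν : Measure (Fin (n + 1) → ℝ)} {E : Set (Fin (n + 1) → ℝ)} {l : ℝ}

lemma measure_box_le_map {T : Set ℝ} (hT : MeasurableSet T) :
    ν (box n T) ≤ ν.map (fun x => x 0) T := by
  rw [Measure.map_apply (measurable_pi_apply 0) hT]
  exact measure_mono (box_subset_preimage T)

lemma setLIntegral_mixedLines_slice_le (hE : MeasurableSet E) (hν : ControlsMixedLines ν E l)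
    {T : Set ℝ} (hT : MeasurableSet T) (hTl : T ⊆ Ioo (-l) l) (i : Fin n) :
    ∫⁻ t in T, cubeMeasure n (mixedLines unitMeasure (slice E t) i) ≤
      ν.map (fun x => x 0) T := by
  calc ∫⁻ t in T, cubeMeasure n (mixedLines unitMeasure (slice E t) i)
      = volume (mixedLines unitMeasure E i.succ ∩ box n T) := by
        simp_rw [← slice_mixedLines_succ]
        exact setLIntegral_cubeMeasure_slice (measurableSet_mixedLines unitMeasure hE i.succ) T
    _ ≤ ENNReal.ofReal (1 / 2 - -(1 / 2)) * ν (box n T) :=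
        hν i.succ _ _ (sides T) (measurableSet_sides hT) rfl (box_mono hTl)
    _ = ν (box n T) := by norm_num
    _ ≤ ν.map (fun x => x 0) T := measure_box_le_map hT

lemma setLIntegral_min_rpow_le (hE : MeasurableSet E) (hν : ControlsMixedLines ν E l)
    {T : Set ℝ} (hT : MeasurableSet T) (hTl : T ⊆ Ioo (-l) l) {α : ℝ} {K : ℝ≥0∞}
    (h : ∀ A : Set (Fin n → ℝ), MeasurableSet A → min (cubeMeasure n A) (cubeMeasure n Aᶜ) ^ α ≤
      K * ∑ i, cubeMeasure n (mixedLines unitMeasure A i)) :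
    ∫⁻ t in T, min (cubeMeasure n (slice E t)) (1 - cubeMeasure n (slice E t)) ^ α ≤
      K * n * ν.map (fun x => x 0) T := by
  have hmeas (i : Fin n) :
      Measurable fun t => cubeMeasure n (mixedLines unitMeasure (slice E t) i) := by
    simp_rw [← slice_mixedLines_succ]
    exact measurable_cubeMeasure_slice (measurableSet_mixedLines unitMeasure hE i.succ)
  calc ∫⁻ t in T, min (cubeMeasure n (slice E t)) (1 - cubeMeasure n (slice E t)) ^ α
      ≤ ∫⁻ t in T, K * ∑ i, cubeMeasure n (mixedLines unitMeasure (slice E t) i) :=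
        lintegral_mono fun t => by
          rw [← prob_compl_eq_one_sub (measurableSet_slice hE t)]
          exact h _ (measurableSet_slice hE t)
    _ = K * ∑ i, ∫⁻ t in T, cubeMeasure n (mixedLines unitMeasure (slice E t) i) := by
        rw [lintegral_const_mul _ (Finset.measurable_fun_sum _ fun i _ => hmeas i),
          lintegral_finsetSum _ fun i _ => hmeas i]
    _ ≤ K * ∑ _i : Fin n, ν.map (fun x => x 0) T := by
        gcongr with i
        exact setLIntegral_mixedLines_slice_le hE hν hT hTl i
    _ = K * n * ν.map (fun x => x 0) T := by simp [mul_assoc]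

lemma cubeMeasure_slice_mixedLines_zero_le (hE : MeasurableSet E) (hν : ControlsMixedLines ν E l)
    {a b : ℝ} (hlt : a < b) (hab : Ioo a b ⊆ Ioo (-l) l) (t : ℝ) :
    cubeMeasure n (slice (mixedLines (volume.restrict (Ioo a b)) E 0) t) ≤
      ν.map (fun x => x 0) (Ioo a b) := by
  rw [← ENNReal.mul_le_mul_iff_right (ENNReal.ofReal_pos.2 (sub_pos.2 hlt)).ne'
    ENNReal.ofReal_ne_top]
  calc _ = ∫⁻ s in Ioo a b,
          cubeMeasure n (slice (mixedLines (volume.restrict (Ioo a b)) E 0) s) := by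
        simp only [slice_mixedLines_zero, setLIntegral_const, Real.volume_Ioo, mul_comm]
    _ = volume (mixedLines (volume.restrict (Ioo a b)) E 0 ∩ box n (Ioo a b)) :=
        setLIntegral_cubeMeasure_slice (measurableSet_mixedLines _ hE 0) _
    _ ≤ ENNReal.ofReal (b - a) * ν (box n (Ioo a b)) :=
        hν 0 a b _ (measurableSet_sides measurableSet_Ioo) rfl (box_mono hab)
    _ ≤ ENNReal.ofReal (b - a) * ν.map (fun x => x 0) (Ioo a b) := by
        gcongr
        exact measure_box_le_map measurableSet_Ioo

lemma exists_ae_cubeMeasure_slice_mem_Icc (hE : MeasurableSet E) (hν : ControlsMixedLines ν E l)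
    {a b : ℝ} (hab : Ioo a b ⊆ Ioo (-l) l) :
    ∃ c, ∀ᵐ t, t ∈ Ioo a b →
      cubeMeasure n (slice E t) ∈ Icc c (c + ν.map (fun x => x 0) (Ioo a b)) := by
  rcases le_or_gt b a with hba | hlt
  · exact ⟨0, Eventually.of_forall fun t ht => absurd (ht.1.trans ht.2) hba.not_gt⟩
  simp only [← ae_restrict_iff' measurableSet_Ioo]
  refine ⟨cubeMeasure n {y | volume.restrict (Ioo a b) {s | y ∉ slice E s} = 0}, ?_⟩
  filter_upwards [ae_slice_ae_le (volume.restrict (Ioo a b)) (cubeMeasure n) hE]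
    with t ⟨hle, hge⟩
  refine ⟨measure_mono_ae hle, (measure_mono_ae hge).trans ((measure_union_le _ _).trans ?_)⟩
  gcongr
  exact cubeMeasure_slice_mixedLines_zero_le hE hν hlt hab t

lemma min_volume_box_le (hl : 1 ≤ l) (hE : MeasurableSet E) (hν : ControlsMixedLines ν E l)
    (hν1 : ν univ < 1) {α : ℝ} (hα : 0 < α) (hα1 : α ≤ 1) {K : ℝ≥0∞} (hK1 : 1 ≤ K)
    (hK : ∀ A : Set (Fin n → ℝ), MeasurableSet A → min (cubeMeasure n A) (cubeMeasure n Aᶜ) ^ α ≤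
      K * ∑ i, cubeMeasure n (mixedLines unitMeasure A i)) :
    min (volume (E ∩ box n (Ioo (-l) l))) (volume (box n (Ioo (-l) l) \ E)) ≤
      (K * (n + 1) + 8 * (K * (n + 1)) ^ 2 * growthConst α) * ν univ := by
  have hmap : ν.map (fun x => x 0) univ = ν univ := by
    rw [Measure.map_apply (measurable_pi_apply 0) MeasurableSet.univ, preimage_univ]
  have : IsFiniteMeasure (ν.map fun x => x 0) := ⟨hmap ▸ hν1.trans ENNReal.one_lt_top⟩
  obtain ⟨S, hSL, hS, hLS, hosc⟩ := exists_measurableSet_forall_le_add_measure_uIcc isOpen_Ioo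
    fun a b hab => exists_ae_cubeMeasure_slice_mem_Icc hE hν hab
  have hSae : S =ᵐ[volume] Ioo (-l) l := hSL.eventuallyLE.antisymm (ae_le_set.2 hLS)
  have hS1 : 1 ≤ volume S := by
    rw [measure_congr hSae, Real.volume_Ioo, ENNReal.one_le_ofReal]
    linarith
  have hmain := min_setLIntegral_le (hmap.trans_lt hν1) (measurable_cubeMeasure_slice hE)
    (fun _ => prob_le_one) (one_le_mul hK1 le_add_self) hα hα1 hS hS1
    (fun T hTS hT => (setLIntegral_min_rpow_le hE hν hT (hTS.trans hSL) hK).trans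
      (by gcongr; exact le_self_add)) hosc
  simp only [← prob_compl_eq_one_sub (measurableSet_slice hE _)] at hmain
  have hcompl : ∫⁻ t in Ioo (-l) l, cubeMeasure n (slice E t)ᶜ =
      volume (box n (Ioo (-l) l) \ E) := by
    rw [sdiff_eq, inter_comm]
    exact setLIntegral_cubeMeasure_slice hE.compl _
  rwa [setLIntegral_congr hSae, setLIntegral_congr hSae, hcompl,
    setLIntegral_cubeMeasure_slice hE, hmap] at hmain

theorem exists_min_volume_box_le (n : ℕ) : ∃ C : ℝ≥0, 1 ≤ C ∧ ∀ l : ℝ, 1 ≤ l →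
    ∀ (ν : Measure (Fin (n + 1) → ℝ)) (E : Set (Fin (n + 1) → ℝ)), MeasurableSet E →
    ControlsMixedLines ν E l → ν univ < 1 →
    min (volume (E ∩ box n (Ioo (-l) l))) (volume (box n (Ioo (-l) l) \ E)) ≤ C * ν univ := by
  obtain ⟨α, hα, hα1, hcube⟩ := exists_min_rpow_le_sum_mixedLines (Fin n)
  set K : ℝ≥0∞ := 2 * Fintype.card (Fin n) + 1
  have hK1 : 1 ≤ K := le_add_self
  have hfin : K * (n + 1) + 8 * (K * (n + 1)) ^ 2 * growthConst α ≠ ∞ := by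
    have := growthConst_ne_top hα1
    finiteness
  refine ⟨(K * (n + 1) + 8 * (K * (n + 1)) ^ 2 * growthConst α).toNNReal, ?_,
    fun l hl ν E hE hν hν1 => ?_⟩
  · rw [← ENNReal.coe_le_coe, ENNReal.coe_toNNReal hfin, ENNReal.coe_one]
    exact (one_le_mul hK1 le_add_self).trans le_self_add
  · rw [ENNReal.coe_toNNReal hfin]
    exact min_volume_box_le hl hE hν hν1 hα hα1.le hK1 (hcube unitMeasure)

end Box

section Transfer

open Module

variable {X Y : Type*} [NormedAddCommGroup X] [NormedSpace ℝ X] [FiniteDimensional ℝ X]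
  [MeasurableSpace X] [BorelSpace X] [NormedAddCommGroup Y] [NormedSpace ℝ Y]
  [FiniteDimensional ℝ Y] [MeasurableSpace Y] [BorelSpace Y]

lemma exists_measure_ball_mul_eq (μ : Measure X) [μ.IsAddHaarMeasure] (ν : Measure Y)
    [ν.IsAddHaarMeasure] (hdim : finrank ℝ X = finrank ℝ Y) (K : ℝ) :
    ∃ M : ℝ≥0∞, M ≠ ∞ ∧ ∀ x y, ∀ r > 0, ν (ball y (K * r)) = M * μ (ball x r) := by
  have hμ0 : μ (ball 0 1) ≠ 0 := (measure_ball_pos _ _ one_pos).ne'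
  have hμt : μ (ball 0 1) ≠ ∞ := measure_ball_lt_top.ne
  refine ⟨ν (ball 0 K) / μ (ball 0 1), ENNReal.div_ne_top measure_ball_lt_top.ne hμ0,
    fun x y r hr => ?_⟩
  rw [mul_comm K, Measure.addHaar_ball_mul_of_pos _ _ hr, Measure.addHaar_ball_of_pos _ _ hr, hdim,
    mul_left_comm, ENNReal.div_mul_cancel hμ0 hμt]

lemma mem_zeroDensityPoints_preimage {μ : Measure X} [μ.IsAddHaarMeasure] {ν : Measure Y}
    [ν.IsAddHaarMeasure] (hdim : finrank ℝ X = finrank ℝ Y) {e : X → Y} {K : ℝ≥0}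
    (he : LipschitzWith K e) {c : ℝ≥0∞} (hc : c ≠ ∞) (hμν : ∀ B, μ (e ⁻¹' B) ≤ c * ν B)
    {A : Set Y} {x : X} (h : e x ∈ zeroDensityPoints ν A) :
    x ∈ zeroDensityPoints μ (e ⁻¹' A) := by
  have hK : 0 < (K + 1 : ℝ) := by positivity
  obtain ⟨M, hM, hball⟩ := exists_measure_ball_mul_eq μ ν hdim (K + 1)
  have hscale : Tendsto (fun r : ℝ => (K + 1) * r) (𝓝[>] 0) (𝓝[>] 0) :=
    tendsto_nhdsWithin_iff.2 ⟨((by fun_prop : Continuous fun r : ℝ => (K + 1) * r).tendsto' 0 0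
      (by simp)).mono_left nhdsWithin_le_nhds,
      eventually_mem_nhdsWithin.mono fun r hr => mul_pos hK hr⟩
  have hlim := ENNReal.Tendsto.const_mul (a := c * M) (Tendsto.comp h hscale)
    (Or.inr (ENNReal.mul_ne_top hc hM))
  rw [mul_zero] at hlim
  refine tendsto_of_tendsto_of_tendsto_of_le_of_le' tendsto_const_nhds hlim
    (Eventually.of_forall fun _ => zero_le)
    (eventually_mem_nhdsWithin.mono fun r (hr : 0 < r) => ?_)
  have hmaps : MapsTo e (ball x r) (ball (e x) ((K + 1) * r)) := fun y hy =>
    (he.dist_le_mul y x).trans_lt (by nlinarith [mem_ball.1 hy, K.coe_nonneg])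
  have hM0 : M ≠ 0 := by
    rintro rfl
    exact (measure_ball_pos ν (e x) (mul_pos hK hr)).ne' (by rw [hball x _ r hr, zero_mul])
  calc μ (e ⁻¹' A ∩ ball x r) / μ (ball x r)
      ≤ c * ν (A ∩ ball (e x) ((K + 1) * r)) / μ (ball x r) := by
        gcongr
        exact (measure_mono (inter_subset_inter_right _ hmaps)).trans (hμν _)
    _ = c * M * (ν (A ∩ ball (e x) ((K + 1) * r)) / ν (ball (e x) ((K + 1) * r))) := by
        rw [hball x _ r hr, mul_assoc, ← mul_div_assoc M, ENNReal.mul_div_mul_left _ _ hM0 hM,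
          mul_div_assoc]

end Transfer

lemma euclideanHausdorffMeasure_image_le {X Y : Type*} [EMetricSpace X] [MeasurableSpace X]
    [BorelSpace X] [EMetricSpace Y] [MeasurableSpace Y] [BorelSpace Y] {K : ℝ≥0} {f : X → Y}
    (hf : LipschitzWith K f) (n : ℕ) (A : Set X) :
    Measure.euclideanHausdorffMeasure n (f '' A) ≤
      K ^ n * Measure.euclideanHausdorffMeasure n A := by
  simp only [Measure.euclideanHausdorffMeasure_def, Measure.smul_apply, ENNReal.smul_def,
    smul_eq_mul]
  rw [mul_left_comm, ← ENNReal.rpow_natCast]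
  gcongr
  exact hf.hausdorffMeasure_image_le n.cast_nonneg A

section EssentialBoundary

variable {d : ℕ} {A B : Set (EuclideanSpace ℝ (Fin d))}

lemma densityPoints_one_subset (hA : MeasurableSet A) :
    densityPoints A 1 ⊆ densityPoints Aᶜ 0 := by
  intro x hx
  have h := ENNReal.Tendsto.sub (tendsto_const_nhds (x := (1 : ℝ≥0∞)) (f := 𝓝[>] (0 : ℝ))) hx
    (Or.inl ENNReal.one_ne_top)
  rw [tsub_self] at h
  refine h.congr' (eventually_mem_nhdsWithin.mono fun r (hr : 0 < r) => ?_)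
  have hsum : volume (A ∩ ball x r) / volume (ball x r) +
      volume (Aᶜ ∩ ball x r) / volume (ball x r) = 1 := by
    rw [← ENNReal.add_div, inter_comm, inter_comm Aᶜ, ← sdiff_eq, measure_inter_add_sdiff _ hA,
      ENNReal.div_self (measure_ball_pos _ _ hr).ne' measure_ball_lt_top.ne]
  rw [← hsum, ENNReal.add_sub_cancel_left
    (ne_top_of_le_ne_top ENNReal.one_ne_top (hsum ▸ le_self_add))]

lemma essentialBoundary_congr (h : A =ᵐ[volume] B) : essentialBoundary A = essentialBoundary B := by
  have : ∀ x r, volume (A ∩ ball x r) = volume (B ∩ ball x r) := fun x r =>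
    measure_congr (h.inter (ae_eq_refl _))
  simp only [essentialBoundary, densityPoints, this]

end EssentialBoundary

section Rescale

/-- The affine parametrization `v ↦ x₀ + σ v` of Euclidean space by coordinates in units of `σ`
centred at `x₀`, in which the cuboid of cross section `σ` has a unit cube as its cross section. -/
noncomputable def rescale {m : ℕ} (x₀ : EuclideanSpace ℝ (Fin m)) {σ : ℝ} (hσ : σ ≠ 0) :
    (Fin m → ℝ) ≃ₜ EuclideanSpace ℝ (Fin m) :=
  (EuclideanSpace.equiv (Fin m) ℝ).symm.toHomeomorph.trans
    ((Homeomorph.smulOfNeZero σ hσ).trans (Homeomorph.addLeft x₀))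

lemma rescale_apply {m : ℕ} (x₀ : EuclideanSpace ℝ (Fin m)) {σ : ℝ} (hσ : σ ≠ 0) (v : Fin m → ℝ) :
    rescale x₀ hσ v = x₀ + σ • WithLp.toLp 2 v :=
  rfl

lemma rescale_symm_apply {m : ℕ} (x₀ : EuclideanSpace ℝ (Fin m)) {σ : ℝ} (hσ : σ ≠ 0)
    (x : EuclideanSpace ℝ (Fin m)) (i : Fin m) :
    (rescale x₀ hσ).symm x i = σ⁻¹ * (x i - x₀ i) := by
  change σ⁻¹ * (-x₀ i + x i) = _
  rw [neg_add_eq_sub]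

lemma exists_lipschitzWith_rescale {m : ℕ} (x₀ : EuclideanSpace ℝ (Fin m)) {σ : ℝ} (hσ : σ ≠ 0) :
    ∃ K, LipschitzWith K (rescale x₀ hσ) :=
  ⟨_, (isometry_add_left x₀).lipschitz.comp
    ((lipschitzWith_smul σ).comp (PiLp.lipschitzWith_toLp 2 _))⟩

lemma volume_preimage_rescale {m : ℕ} (x₀ : EuclideanSpace ℝ (Fin m)) {σ : ℝ} (hσ : σ ≠ 0)
    (A : Set (EuclideanSpace ℝ (Fin m))) :
    volume (rescale x₀ hσ ⁻¹' A) = ENNReal.ofReal |(σ ^ m)⁻¹| * volume A := by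
  have hpre : rescale x₀ hσ ⁻¹' A = MeasurableEquiv.toLp 2 (Fin m → ℝ) ⁻¹'
      ((fun x => σ • x) ⁻¹' ((fun x => x₀ + x) ⁻¹' A)) := rfl
  rw [hpre, (PiLp.volume_preserving_toLp (Fin m)).measure_preimage_equiv,
    Measure.addHaar_preimage_smul _ hσ, measure_preimage_add, finrank_euclideanSpace_fin]

variable {n : ℕ} (x₀ : EuclideanSpace ℝ (Fin (n + 1))) {σ : ℝ}

lemma rescale_preimage_cuboid (hσ : 0 < σ) (l : ℝ) :
    rescale x₀ hσ.ne' ⁻¹' cuboid x₀ l σ = box n (Ioo (-(l / σ)) (l / σ)) := by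
  have hscale : ∀ t a : ℝ, σ * t ∈ Ioo (-a) a ↔ t ∈ Ioo (-(a / σ)) (a / σ) := fun t a => by
    rw [mem_Ioo, mem_Ioo, ← neg_div, div_lt_iff₀' hσ, lt_div_iff₀' hσ]
  have hhalf : σ / 2 / σ = 1 / 2 := by field_simp
  ext v
  rw [box, Set.mem_pi, Fin.forall_fin_succ, mem_preimage, cuboid, mem_ofPred_eq,
    Fin.forall_fin_succ]
  simp [rescale_apply, hscale, hhalf, sides]

lemma lipschitzWith_insertCoord (j : Fin (n + 1)) : LipschitzWith 1 (insertCoord j) :=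
  LipschitzWith.of_dist_le_mul fun p q => by
    rw [NNReal.coe_one, one_mul, dist_pi_le_iff dist_nonneg, Fin.forall_iff_succAbove j,
      insertCoord_apply j p.1, insertCoord_apply j q.1]
    simp only [Fin.insertNth_apply_same, Fin.insertNth_apply_succAbove]
    exact ⟨le_max_left _ _, fun k => (dist_le_pi_dist _ _ k).trans (le_max_right _ _)⟩

lemma rescale_insertCoord_mem_essentialBoundary (hσ : σ ≠ 0)
    {A : Set (EuclideanSpace ℝ (Fin (n + 1)))} (hA : MeasurableSet A) (j : Fin (n + 1))
    {q : ℝ × (Fin n → ℝ)}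
    (hq : q ∉ zeroDensityPoints (volume.prod volume) (insertCoord j ⁻¹' (rescale x₀ hσ ⁻¹' A)) ∪
      zeroDensityPoints (volume.prod volume) (insertCoord j ⁻¹' (rescale x₀ hσ ⁻¹' A))ᶜ) :
    rescale x₀ hσ (insertCoord j q) ∈ essentialBoundary A := by
  obtain ⟨K, hK⟩ := exists_lipschitzWith_rescale x₀ hσ
  have hdensity : ∀ B : Set (EuclideanSpace ℝ (Fin (n + 1))),
      rescale x₀ hσ (insertCoord j q) ∈ densityPoints B 0 →
      q ∈ zeroDensityPoints (volume.prod volume) (insertCoord j ⁻¹' (rescale x₀ hσ ⁻¹' B)) :=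
    fun B h => mem_zeroDensityPoints_preimage (μ := volume.prod volume) (ν := volume)
      (by simp [add_comm])
      (hK.comp (lipschitzWith_insertCoord j)) ENNReal.ofReal_ne_top
      (fun B => ((volume_preimage_insertCoord j _).trans (volume_preimage_rescale x₀ hσ B)).le) h
  rintro (h | h)
  · exact hq (Or.inl (hdensity A h))
  · exact hq (Or.inr (hdensity Aᶜ (densityPoints_one_subset hA h)))

lemma lipschitzWith_removeNth_rescale_symm (hσ : σ ≠ 0) (j : Fin (n + 1)) :
    LipschitzWith (Real.nnabs σ⁻¹) fun x =>
      WithLp.toLp 2 (j.removeNth ((rescale x₀ hσ).symm x)) := by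
  refine LipschitzWith.of_dist_le_mul fun x y => ?_
  rw [Real.coe_nnabs, EuclideanSpace.dist_eq, EuclideanSpace.dist_eq, ← Real.sqrt_sq_eq_abs,
    ← Real.sqrt_mul (sq_nonneg _)]
  refine Real.sqrt_le_sqrt ?_
  rw [Fin.sum_univ_succAbove _ j, mul_add, Finset.mul_sum]
  refine le_add_of_nonneg_of_le (by positivity) (Finset.sum_le_sum fun k _ => le_of_eq ?_)
  simp only [Fin.removeNth, rescale_symm_apply, Real.dist_eq, sq_abs]
  ring

lemma volume_image_removeNth_rescale_symm_le (hσ : σ ≠ 0) (j : Fin (n + 1))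
    (A : Set (EuclideanSpace ℝ (Fin (n + 1)))) :
    volume ((fun x => j.removeNth ((rescale x₀ hσ).symm x)) '' A) ≤
      ENNReal.ofReal |(σ ^ n)⁻¹| * Measure.euclideanHausdorffMeasure n A := by
  set p : EuclideanSpace ℝ (Fin (n + 1)) → EuclideanSpace ℝ (Fin n) :=
    fun x => WithLp.toLp 2 (j.removeNth ((rescale x₀ hσ).symm x))
  have himage : (fun x => j.removeNth ((rescale x₀ hσ).symm x)) '' A =
      MeasurableEquiv.toLp 2 (Fin n → ℝ) ⁻¹' (p '' A) := by
    rw [← MeasurableEquiv.image_symm, image_image]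
    rfl
  rw [himage, (PiLp.volume_preserving_toLp (Fin n)).measure_preimage_equiv,
    ← EuclideanSpace.euclideanHausdorffMeasure_eq_volume]
  refine (euclideanHausdorffMeasure_image_le
    (lipschitzWith_removeNth_rescale_symm x₀ hσ j) n A).trans_eq ?_
  rw [← inv_pow, abs_pow, ENNReal.ofReal_pow (abs_nonneg _), ← Real.coe_nnabs,
    ENNReal.ofReal_coe_nnreal]

lemma ae_exists_rescale_insertCoord_mem_essentialBoundary (hσ : σ ≠ 0)
    {A : Set (EuclideanSpace ℝ (Fin (n + 1)))} (hA : MeasurableSet A) (j : Fin (n + 1)) :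
    ∀ᵐ z : Fin n → ℝ, ∀ a b s, insertCoord j (s, z) ∈
      mixedLines (volume.restrict (Ioo a b)) (rescale x₀ hσ ⁻¹' A) j →
      ∃ t ∈ Ioo a b, rescale x₀ hσ (insertCoord j (t, z)) ∈ essentialBoundary A := by
  have hE : MeasurableSet (insertCoord j ⁻¹' (rescale x₀ hσ ⁻¹' A)) :=
    (insertCoord j).measurable ((rescale x₀ hσ).continuous.measurable hA)
  filter_upwards [ae_forall_volume_Ioo_slice_eq_zero_or volume hE] with z hz a b s hmixed
  by_contra! hboundary
  simp only [mixedLines, lineFraction, mem_ofPred_eq, update_insertCoord, mem_compl_iff,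
    Measure.restrict_apply₀' measurableSet_Ioo.nullMeasurableSet] at hmixed
  refine (hz a b fun t ht => ?_).elim (fun h => hmixed.1 ?_) fun h => hmixed.2 ?_
  · by_contra hq
    exact hboundary t ht (rescale_insertCoord_mem_essentialBoundary x₀ hσ hA j hq)
  · rwa [inter_comm]
  · rwa [inter_comm]

lemma controlsMixedLines_rescale (hσ : 0 < σ) (l : ℝ)
    {A : Set (EuclideanSpace ℝ (Fin (n + 1)))} (hA : MeasurableSet A) :
    ControlsMixedLines
      (ENNReal.ofReal |(σ ^ n)⁻¹| • ((Measure.euclideanHausdorffMeasure n).restrict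
        (essentialBoundary A ∩ cuboid x₀ l σ)).map (rescale x₀ hσ.ne').symm)
      (rescale x₀ hσ.ne' ⁻¹' A) (l / σ) := by
  intro j a b S hS hSj hSbox
  set e := rescale x₀ hσ.ne'
  set B := e.symm ⁻¹' univ.pi S ∩ (essentialBoundary A ∩ cuboid x₀ l σ)
  have hpi : insertCoord j ⁻¹' univ.pi S = Ioo a b ×ˢ univ.pi (j.removeNth S) :=
    hSj ▸ insertCoord_preimage_pi j S
  have hproj : insertCoord j ⁻¹' (mixedLines (volume.restrict (Ioo a b)) (e ⁻¹' A) j ∩ univ.pi S)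
      ≤ᵐ[volume.prod volume] (Ioo a b ×ˢ ((fun x => j.removeNth (e.symm x)) '' B) : Set _) := by
    filter_upwards [Measure.quasiMeasurePreserving_snd.ae
      (ae_exists_rescale_insertCoord_mem_essentialBoundary x₀ hσ.ne' hA j)]
      with ⟨s, z⟩ hz ⟨hmixed, hS⟩
    have hsz : (s, z) ∈ Ioo a b ×ˢ univ.pi (j.removeNth S) := hpi ▸ hS
    obtain ⟨t, ht, hbd⟩ := hz a b s hmixed
    have htS : insertCoord j (t, z) ∈ univ.pi S := by
      rw [← mem_preimage, hpi]
      exact ⟨ht, hsz.2⟩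
    refine ⟨hsz.1, e (insertCoord j (t, z)), ⟨?_, hbd, ?_⟩, ?_⟩
    · rwa [mem_preimage, e.symm_apply_apply]
    · exact (rescale_preimage_cuboid x₀ hσ l).ge (hSbox htS)
    · simp [insertCoord_apply]
  have hpiS : MeasurableSet (univ.pi S) := .univ_pi hS
  have hsymm : Measurable e.symm := e.symm.continuous.measurable
  calc volume (mixedLines (volume.restrict (Ioo a b)) (e ⁻¹' A) j ∩ univ.pi S)
      ≤ volume.prod volume (Ioo a b ×ˢ ((fun x => j.removeNth (e.symm x)) '' B)) :=
        (volume_preimage_insertCoord j _).ge.trans (measure_mono_ae hproj)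
    _ ≤ ENNReal.ofReal (b - a) *
        (ENNReal.ofReal |(σ ^ n)⁻¹| * Measure.euclideanHausdorffMeasure n B) := by
        rw [Measure.prod_prod, Real.volume_Ioo]
        gcongr
        exact volume_image_removeNth_rescale_symm_le x₀ hσ.ne' j B
    _ = _ := by
        rw [Measure.smul_apply, Measure.map_apply hsymm hpiS, Measure.restrict_apply (hsymm hpiS),
          smul_eq_mul]

theorem exists_min_volume_cuboid_le (n : ℕ) : ∃ C : ℝ≥0, 1 ≤ C ∧ ∀ l σ : ℝ, 0 < σ → 1 ≤ l / σ →
    ∀ (x₀ : EuclideanSpace ℝ (Fin (n + 1))) (A : Set (EuclideanSpace ℝ (Fin (n + 1)))),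
    MeasurableSet A → relativePerimeter A (cuboid x₀ l σ) < ENNReal.ofReal (σ ^ n) →
    min (volume (A ∩ cuboid x₀ l σ)) (volume (cuboid x₀ l σ \ A)) ≤
      ENNReal.ofReal (C * σ) * relativePerimeter A (cuboid x₀ l σ) := by
  obtain ⟨C, hC, hbox⟩ := exists_min_volume_box_le n
  refine ⟨C, hC, fun l σ hσ hlσ x₀ A hA hlt => ?_⟩
  set S := cuboid x₀ l σ
  have hscale : ∀ (m : ℕ) (V : ℝ≥0∞),
      ENNReal.ofReal (σ ^ m) * (ENNReal.ofReal |(σ ^ m)⁻¹| * V) = V := fun m V => by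
    rw [← mul_assoc, ← ENNReal.ofReal_mul (by positivity), abs_of_pos (by positivity),
      mul_inv_cancel₀ (by positivity), ENNReal.ofReal_one, one_mul]
  have hsmall : ENNReal.ofReal |(σ ^ n)⁻¹| * relativePerimeter A S < 1 := by
    rwa [← ENNReal.mul_lt_mul_iff_right (ENNReal.ofReal_pos.2 (pow_pos hσ n)).ne'
      ENNReal.ofReal_ne_top, hscale, mul_one]
  have h := hbox (l / σ) hlσ _ _ ((rescale x₀ hσ.ne').continuous.measurable hA)
    (controlsMixedLines_rescale x₀ hσ l hA)
  rw [Measure.smul_apply, Measure.map_apply (rescale x₀ hσ.ne').symm.continuous.measurable .univ,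
    preimage_univ, Measure.restrict_apply_univ, smul_eq_mul, ← rescale_preimage_cuboid x₀ hσ,
    ← preimage_inter, ← preimage_sdiff, volume_preimage_rescale, volume_preimage_rescale] at h
  calc min (volume (A ∩ S)) (volume (S \ A))
      = ENNReal.ofReal (σ ^ (n + 1)) * min (ENNReal.ofReal |(σ ^ (n + 1))⁻¹| * volume (A ∩ S))
          (ENNReal.ofReal |(σ ^ (n + 1))⁻¹| * volume (S \ A)) := by
        rw [mul_min, hscale, hscale]
    _ ≤ ENNReal.ofReal (σ ^ (n + 1)) *
          (C * (ENNReal.ofReal |(σ ^ n)⁻¹| * relativePerimeter A S)) := by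
        gcongr
        exact h hsmall
    _ = ENNReal.ofReal σ * C *
          (ENNReal.ofReal (σ ^ n) * (ENNReal.ofReal |(σ ^ n)⁻¹| * relativePerimeter A S)) := by
        rw [pow_succ, ENNReal.ofReal_mul (by positivity)]
        ring
    _ = ENNReal.ofReal (C * σ) * relativePerimeter A S := by
        rw [hscale, ENNReal.ofReal_mul C.coe_nonneg, ENNReal.ofReal_coe_nnreal, mul_comm (C : ℝ≥0∞)]

end Rescale

end LongCuboid

theorem proposition3p8_general (d : ℕ) (hd : 1 ≤ d) :
    ∃ C : ℝ, 1 ≤ C ∧ ∀ l σ : ℝ, 0 < σ → 1 ≤ l / σ →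
      ∀ (x₀ : EuclideanSpace ℝ (Fin d)) (P : Set (EuclideanSpace ℝ (Fin d))),
        NullMeasurableSet P volume →
        LongCuboid.relativePerimeter P (LongCuboid.cuboid x₀ l σ) < ENNReal.ofReal (σ ^ (d - 1)) →
        min (volume (P ∩ LongCuboid.cuboid x₀ l σ)) (volume (LongCuboid.cuboid x₀ l σ \ P)) ≤
          ENNReal.ofReal (C * σ) *
            LongCuboid.relativePerimeter P (LongCuboid.cuboid x₀ l σ) := by
  obtain ⟨n, rfl⟩ : ∃ n, d = n + 1 := ⟨d - 1, by omega⟩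
  obtain ⟨C, hC, hcuboid⟩ := LongCuboid.exists_min_volume_cuboid_le n
  refine ⟨C, hC, fun l σ hσ hlσ x₀ P hP hlt => ?_⟩
  obtain ⟨A, hA, hPA⟩ := hP
  have hperimeter : ∀ U, LongCuboid.relativePerimeter P U = LongCuboid.relativePerimeter A U :=
    fun U => by simp only [LongCuboid.relativePerimeter, LongCuboid.essentialBoundary_congr hPA]
  rw [hperimeter] at hlt ⊢
  rw [measure_congr (hPA.inter (ae_eq_refl (LongCuboid.cuboid x₀ l σ))),
    measure_congr ((ae_eq_refl (LongCuboid.cuboid x₀ l σ)).diff hPA)]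
  exact hcuboid l σ hσ hlσ x₀ A hA hlt

theorem proposition3p8 (d : ℕ) (hd : 1 ≤ d) :
    ∃ C : ℝ, 1 ≤ C ∧
      ∀ (l σ : ℝ), 0 < l → 0 < σ → 1 ≤ l / σ →
      ∀ (x₀ : EuclideanSpace ℝ (Fin d)) (P : Set (EuclideanSpace ℝ (Fin d))),
        P ⊆ LongCuboid.cuboid x₀ l σ →
        LongCuboid.HasFinitePerimeterIn P (LongCuboid.cuboid x₀ l σ) →
        LongCuboid.relativePerimeter P (LongCuboid.cuboid x₀ l σ) < ENNReal.ofReal (σ ^ (d - 1)) →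
        min (volume P) (volume (LongCuboid.cuboid x₀ l σ \ P)) ≤
          ENNReal.ofReal (C * σ) *
            LongCuboid.relativePerimeter P (LongCuboid.cuboid x₀ l σ) := by
  obtain ⟨C, hC, hmain⟩ := proposition3p8_general d hd
  exact ⟨C, hC, fun l σ _ hσ hlσ x₀ P hP hper hlt =>
    by simpa only [inter_eq_left.2 hP] using hmain l σ hσ hlσ x₀ P hper.nullMeasurableSet hlt⟩
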